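/- Consider a multi-hop network with a finite node set $\mathcal N$, a symmetric neighbour relation (bidirectional links) and a finite set $\mathcal F$ of flows, flow $f$ having source set $\mathcal S_f$ and destination set $\mathcal D_f$. A node $n$ that uses the fraction $r\in[0,1]$ of its power $P_n>0$ towards a neighbour $m$ obtains the link capacity $$c_{n,m}(r)=\alpha_1T_{\mathrm f}W\log_2\Bigl(1+\alpha_2\frac{rP_nG_{n,m}g_{n,m}}{WN_0}\Bigr),\qquad G_{n,m}=|\mathbf w^{\mathrm r}_{n,m}\mathbf H_{n,m}\mathbf w^{\mathrm t}_{n,m}|^2,$$ with $\alpha_1,\alpha_2,T_{\mathrm f},W,N_0,g_{n,m}>0$, channel matrix $\mathbf H_{n,m}\neq0$ and unit beamforming vectors $\mathbf w^{\mathrm r}_{n,m},\mathbf w^{\mathrm t}_{n,m}$ maximizing $|\mathbf w^{\mathrm r}\mathbf H_{n,m}\mathbf w^{\mathrm t}|$. For roles $\mathbf s\in\{0,1\}^{\mathcal N}$ ($s_n=1$ if $n$ transmits), $\Pi(\mathbf s)$ is the set of power allocations $\mathbf p=(p_{n,m})$, $p_{n,m}\ge0$, supported on the links, with $p_{n,m}\le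 s_n(1-s_m)$ and $\sum_mp_{n,m}\le1$. In each frame $t$ a causal scheduling policy, which may be randomized, chooses $\mathbf s(t)$, $\mathbf p(t)\in\Pi(\mathbf s(t))$ and rates $c^f_{n,m}(t)\ge0$ with $\sum_fc^f_{n,m}(t)\le c_{n,m}(p_{n,m}(t))$ and $\sum_mc^f_{n,m}(t)\le q_n^f(t)$. The queues start at deterministic nonnegative values, vanish at destinations ($q_n^f=0$ for $n\in\mathcal D_f$), and otherwise $$q_n^f(t+1)=q_n^f(t)+\sum_m\bigl(c_{m,n}^f(t)-c_{n,m}^f(t)\bigr)+a_n^f(t),$$ where the arrivals $a_n^f(t)\ge0$ are uniformly bounded and vanish for $n\notin\mathcal S_f$. The network is called stable if, for the total queue length $|\mathbf q(t)|_1$, (i) there is a constant $B$ such that with probability one $|\mathbf q(t)|_1\le B$ for infinitely many $t$, and (ii) $\limsup_{T\to\infty}\frac1T\sum_{t<T}\mathbb E|\mathbf q(t)|_1<\infty$. The throughput capacity region $\Lambda$ is the set of rate vectors $\mathbf x$ for which there are arrivals with long-term mean rates $\mathbf x$, i.e. $\frac1T\sum_{t<T}\mathbb E\,\mathbf a(t)\to\mathbf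 x$, and a scheduling policy making the network stable. A policy is throughput optimal if it makes the network stable for every $\mathbf x$ strictly inside $\Lambda$ (that is, $\rho\mathbf x\in\Lambda$ for some $\rho>1$), every initial queue vector and all inelastic arrivals with mean rates $\mathbf x$, i.e. $\mathbf a(t)$ is independent of the past and $\mathbb E\,\mathbf a(t)=\mathbf x$ for every $t$. The Pick-and-Compare scheduler works as follows. Put $Q_{n,m}=\max_f(q_n^f-q_m^f)$ and $w(\mathbf q,\mathbf s)=\max_{\mathbf p\in\Pi(\mathbf s)}\sum_{n,m}c_{n,m}(p_{n,m})Q_{n,m}$. The initial roles are arbitrary. In every later frame $t$ it draws new roles $\tilde{\mathbf s}(t)$, independently of the past, from a fixed law that gives every role vector positive probability, and it uses $\mathbf s(t)=\mathbf s(t-1)$ if $w(\mathbf q(t),\mathbf s(t-1))>w(\mathbf q(t),\tilde{\mathbf s}(t))$ and $\mathbf s(t)=\tilde{\mathbf s}(t)$ otherwise. Then it uses any maximizer $\mathbf p(t)\in\Pi(\mathbf s(t))$ of $\sum_{n,m}c_{n,m}(p_{n,m})Q_{n,m}$; each link $(n,m)$ serves only one flow $f^*_{n,m}$ maximizing $q_n^f-q_m^f$,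 at the rate $\min(c_{n,m},q_n^{f}\xi_{n,m})$ with $f=f^*_{n,m}$ and $\xi_{n,m}=c_{n,m}/\sum_{m':f^*_{n,m'}=f^*_{n,m}}c_{n,m'}$. Proposition. The Pick-and-Compare scheduler is throughput optimal. -/

import Mathlib

open MeasureTheory ProbabilityTheory Filter
open scoped Topology ENNReal

universe u v w

/-- A pair of beamforming vectors for the channel matrix `H`: unit vectors that maximize
`|wr H wt|²` among all pairs of unit vectors. -/
structure IsBeamformer {A : ℕ} (H : Matrix (Fin A) (Fin A) ℂ) (wr wt : Fin A → ℂ) : Prop where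
  unit_r : ∑ i, ‖wr i‖ ^ 2 = 1
  unit_t : ∑ i, ‖wt i‖ ^ 2 = 1
  maximal : ∀ vr vt : Fin A → ℂ, ∑ i, ‖vr i‖ ^ 2 = 1 → ∑ i, ‖vt i‖ ^ 2 = 1 →
    ‖vr ⬝ᵥ (H.mulVec vt)‖ ^ 2 ≤ ‖wr ⬝ᵥ (H.mulVec wt)‖ ^ 2

/-- A multi-hop millimetre-wave network with nodes `N` and traffic flows `F`. Links are
bidirectional: `links.Adj n m` means that each of `n`, `m` can transmit to the other. -/
structure MmWaveNetwork (N : Type v) (F : Type w) where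
  /-- the neighbour relation -/
  links : SimpleGraph N
  /-- number of antennas of each array -/
  antennas : ℕ
  /-- small-scale fading matrix of the channel from `n` to `m` -/
  H : N → N → Matrix (Fin antennas) (Fin antennas) ℂ
  H_ne_zero : ∀ n m, links.Adj n m → H n m ≠ 0
  /-- receive and transmit beamforming vectors of the link from `n` to `m` -/
  wr : N → N → Fin antennas → ℂ
  wt : N → N → Fin antennas → ℂ
  beamformer : ∀ n m, links.Adj n m → IsBeamformer (H n m) (wr n m) (wt n m)
  /-- macroscopic path gain, in linear scale -/
  g : N → N → ℝ
  g_pos : ∀ n m, links.Adj n m → 0 < g n m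
  /-- total transmit power of each node -/
  P : N → ℝ
  P_pos : ∀ n, 0 < P n
  /-- bandwidth -/
  W : ℝ
  W_pos : 0 < W
  /-- noise power spectral density -/
  N₀ : ℝ
  N₀_pos : 0 < N₀
  /-- frame duration -/
  Tf : ℝ
  Tf_pos : 0 < Tf
  /-- bandwidth penalty factor -/
  α₁ : ℝ
  α₁_pos : 0 < α₁
  /-- power penalty factor -/
  α₂ : ℝ
  α₂_pos : 0 < α₂
  /-- sources and destinations of each flow -/
  src : F → Finset N
  dst : F → Finset N

namespace MmWaveNetwork

variable {N : Type v} {F : Type w} (net : MmWaveNetwork N F)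

/-- Beamforming gain of the link from `n` to `m`. -/
noncomputable def gain (n m : N) : ℝ :=
  ‖net.wr n m ⬝ᵥ ((net.H n m).mulVec (net.wt n m))‖ ^ 2

/-- Capacity, in bits per frame, of the link from `n` to `m` when `n` uses the fraction `r` of its
power towards `m`. -/
noncomputable def linkRate (n m : N) (r : ℝ) : ℝ :=
  net.α₁ * net.Tf * net.W *
    Real.logb 2 (1 + net.α₂ * ((r * net.P n) * net.gain n m * net.g n m / (net.W * net.N₀)))

variable [Fintype N]

/-- The power allocations compatible with the roles `s` (`s n = true` when `n` transmits):
power is spent on links only, and the half-duplex and sum-power constraints hold. -/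
def powerSet (s : N → Bool) : Set (N → N → ℝ) :=
  {p | (∀ n m, 0 ≤ p n m) ∧
    (∀ n m, ¬ net.links.Adj n m → p n m = 0) ∧
    (∀ n m, p n m ≤ ((s n).toNat : ℝ) * (1 - ((s m).toNat : ℝ))) ∧
    ∀ n, ∑ m, p n m ≤ 1}

variable [Fintype F]

/-- Back pressure of the pair `(n, m)`: the largest queue difference over the flows. -/
noncomputable def backPressure (q : N → F → ℝ) (n m : N) : ℝ := ⨆ f, (q n f - q m f)

/-- Total back-pressure weight of the power allocation `p`. -/
noncomputable def weight (q : N → F → ℝ) (p : N → N → ℝ) : ℝ :=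
  ∑ n, ∑ m, net.linkRate n m (p n m) * backPressure q n m

/-- Largest back-pressure weight over the power allocations compatible with the roles `s`. -/
noncomputable def maxWeight (q : N → F → ℝ) (s : N → Bool) : ℝ :=
  sSup (net.weight q '' net.powerSet s)

/-- `c n m f` is the rate of the link from `n` to `m` given to flow `f`. The rates of a link do not
exceed its capacity, and no queue sends more packets than it holds. -/
structure FeasibleRates (q : N → F → ℝ) (p : N → N → ℝ) (c : N → N → F → ℝ) : Prop where
  nonneg : ∀ n m f, 0 ≤ c n m f
  le_capacity : ∀ n m, ∑ f, c n m f ≤ net.linkRate n m (p n m)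
  le_queue : ∀ n f, ∑ m, c n m f ≤ q n f

/-- The back-pressure assignment of rates to flows: each link serves one flow `fs n m` with the
largest queue difference, and the links of `n` serving the same flow share its queue in proportion
to their capacities. -/
def BackPressureRates [DecidableEq F] (q : N → F → ℝ) (p : N → N → ℝ) (c : N → N → F → ℝ) :
    Prop :=
  ∃ fs : N → N → F,
    (∀ n m f, q n f - q m f ≤ q n (fs n m) - q m (fs n m)) ∧
    ∀ n m f, c n m f =
      if f = fs n m then
        min (net.linkRate n m (p n m))
          (q n f * (net.linkRate n m (p n m) /
            ∑ m' with fs n m' = fs n m, net.linkRate n m' (p n m')))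
      else 0

/-- A (random) time evolution of the network under some causal scheduling policy. The σ-algebra
`ℱ t` is the information, private randomness included, on which the schedule of frame `t` is based;
the arrivals of frame `t` belong to `ℱ (t + 1)`. -/
structure Evolution [DecidableEq N] where
  Ω : Type u
  [mΩ : MeasurableSpace Ω]
  μ : Measure Ω
  [prob : IsProbabilityMeasure μ]
  ℱ : Filtration ℕ mΩ
  /-- exogenous arrivals `a t ω n f` at node `n` for flow `f` during frame `t` -/
  a : ℕ → Ω → N → F → ℝ
  /-- transmitter roles -/
  s : ℕ → Ω → N → Bool
  /-- power allocations -/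
  p : ℕ → Ω → N → N → ℝ
  /-- link rates given to the flows -/
  c : ℕ → Ω → N → N → F → ℝ
  /-- queue lengths -/
  q : ℕ → Ω → N → F → ℝ
  /-- initial queue lengths -/
  q₀ : N → F → ℝ
  a_measurable : ∀ t, Measurable[ℱ (t + 1)] (a t)
  a_nonneg : ∀ t ω n f, 0 ≤ a t ω n f
  a_bounded : ∃ A : ℝ, ∀ t ω n f, a t ω n f ≤ A
  a_src : ∀ t ω n f, n ∉ net.src f → a t ω n f = 0
  s_measurable : ∀ t, Measurable[ℱ t] (s t)
  p_measurable : ∀ t, Measurable[ℱ t] (p t)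
  c_measurable : ∀ t, Measurable[ℱ t] (c t)
  p_mem : ∀ t ω, p t ω ∈ net.powerSet (s t ω)
  c_feasible : ∀ t ω, net.FeasibleRates (q t ω) (p t ω) (c t ω)
  q₀_nonneg : ∀ n f, 0 ≤ q₀ n f
  q₀_dst : ∀ n f, n ∈ net.dst f → q₀ n f = 0
  q_zero : ∀ ω, q 0 ω = q₀
  q_succ : ∀ t ω n f, q (t + 1) ω n f =
    if n ∈ net.dst f then 0
    else q t ω n f + ∑ m, (c t ω m n f - c t ω n m f) + a t ω n f

attribute [instance] Evolution.mΩ Evolution.prob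

namespace Evolution

variable {net} [DecidableEq N] (E : Evolution net)

/-- Total number of packets in the network (the queues are nonnegative). -/
noncomputable def backlog (t : ℕ) (ω : E.Ω) : ℝ := ∑ n, ∑ f, E.q t ω n f

/-- Stability: with probability one the backlog returns again and again below some fixed level,
and its long-term time average is finite in expectation. -/
def Stable : Prop :=
  (∃ B : ℝ, ∀ᵐ ω ∂E.μ, ∃ᶠ t in atTop, E.backlog t ω ≤ B) ∧
  ∃ B : ℝ, ∀ T : ℕ, 0 < T → (∑ t ∈ Finset.range T, ∫ ω, E.backlog t ω ∂E.μ) / T ≤ B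

/-- The arrivals have long-term mean rates `x` (their means may vary with time). -/
def HasLongTermRate (x : N → F → ℝ) : Prop :=
  ∀ n f, Tendsto (fun T : ℕ => (∑ t ∈ Finset.range T, ∫ ω, E.a t ω n f ∂E.μ) / T) atTop (𝓝 (x n f))

/-- Inelastic traffic with mean rates `x`: in each frame the arrivals are independent of the past
and have mean `x`. -/
def HasFixedRate (x : N → F → ℝ) : Prop :=
  ∀ t, Indep (MeasurableSpace.comap (E.a t) inferInstance) (E.ℱ t) E.μ ∧
    ∀ n f, ∫ ω, E.a t ω n f ∂E.μ = x n f

/-- The evolution is driven by the Pick-and-Compare scheduler. In frame `t + 1` new roles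
`pick (t + 1)` are drawn, independently of the past, from a fixed law `ν` that charges every role
vector; the previous roles are repeated when their largest back-pressure weight, for the current
queues, exceeds that of the new ones, and the new roles are used otherwise. The power allocation is
optimal for the roles in use. -/
def IsPickAndCompare [DecidableEq F] : Prop :=
  (∃ (pick : ℕ → E.Ω → N → Bool) (ν : (N → Bool) → ℝ≥0∞),
    (∀ r, 0 < ν r) ∧
    ∀ t, Measurable[E.ℱ (t + 1)] (pick (t + 1)) ∧
      Indep (MeasurableSpace.comap (pick (t + 1)) inferInstance) (E.ℱ t) E.μ ∧
      (∀ r, E.μ (pick (t + 1) ⁻¹' {r}) = ν r) ∧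
      ∀ ω, E.s (t + 1) ω =
        if net.maxWeight (E.q (t + 1) ω) (E.s t ω) >
            net.maxWeight (E.q (t + 1) ω) (pick (t + 1) ω)
        then E.s t ω else pick (t + 1) ω) ∧
  ∀ t ω, IsMaxOn (net.weight (E.q t ω)) (net.powerSet (E.s t ω)) (E.p t ω) ∧
    net.BackPressureRates (E.q t ω) (E.p t ω) (E.c t ω)

end Evolution

variable [DecidableEq N]

/-- The throughput capacity region: the long-term mean rate vectors for which some scheduling
policy makes the network stable. -/
def capacityRegion : Set (N → F → ℝ) :=
  {x | ∃ E : Evolution.{0, v, w} net, E.HasLongTermRate x ∧ E.Stable}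

/-- Rate vectors strictly inside the capacity region: a proportional increase of the rates stays in
the region. It contains every point of the interior of the region relative to the orthant of the
admissible rate vectors. -/
def strictCapacityRegion : Set (N → F → ℝ) :=
  {x | ∃ ρ : ℝ, 1 < ρ ∧ ρ • x ∈ net.capacityRegion}

/-- A scheduling policy, given by the evolutions that it generates, is throughput optimal if it
makes the network stable for all mean rates strictly inside the capacity region. -/
def ThroughputOptimal (policy : Set (Evolution.{u, v, w} net)) : Prop :=
  ∀ x ∈ net.strictCapacityRegion, ∀ E ∈ policy, E.HasFixedRate x → E.Stable

end MmWaveNetwork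

set_option linter.unusedSectionVars false

/-! The proof is a Foster–Lyapunov argument for the function `energy + θ * gap`. Here `energy` is
the sum of squared queues, and `gap` is the back-pressure weight that the roles in use lose against
the best roles, whose weight is `optWeight`.

Energy: the increments of the queues are bounded, and the back-pressure rates lose only a bounded
part of the weight, so the energy grows by at most a constant plus `2 q·a - 2 (optWeight q - gap)`
(`exists_energy_succ_le`). Given the past, `q·a` has mean `q·x`. Any policy removes at most
`optWeight y` per frame from a functional `y·q` with `y ≥ 0` that ignores destinations. Hence a
stable policy forces `y·z ≤ optWeight y` for every `z` in the capacity region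
(`sum_mul_le_optWeight`). With `z = ρ • x` and `y = q` this gives `q·x ≤ ρ⁻¹ optWeight q`, which
leaves a negative drift proportional to `optWeight q`, apart from the term `2 gap`.

Gap: weights are Lipschitz in the queues, so the gap of a fixed role vector changes by a bounded
amount per frame, and the comparison step never selects the worse of its two candidates. With
probability at least `η > 0` the draw is optimal for the current queues. Hence the conditional mean
of the next gap is at most `K + (1 - η) gap` (`exists_setIntegral_gap_succ_le`), and `θ = 2 / η`
absorbs `2 gap`.

Finally, `optWeight` dominates a multiple of all queues that can reach a destination
(`exists_servedBacklog_le`). The other queues receive almost surely no arrivals, so their total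
never exceeds its initial value (`ae_backlog_le`). -/

lemma IsBeamformer.norm_pos {A : ℕ} {H : Matrix (Fin A) (Fin A) ℂ} {wr wt : Fin A → ℂ}
    (h : IsBeamformer H wr wt) (hH : H ≠ 0) : 0 < ‖wr ⬝ᵥ (H.mulVec wt)‖ ^ 2 := by
  obtain ⟨i, j, hij⟩ : ∃ i j, H i j ≠ 0 := by
    by_contra! hc
    exact hH (by ext i j; exact hc i j)
  have hunit : ∀ k : Fin A, ∑ l, ‖(Pi.single k (1 : ℂ) : Fin A → ℂ) l‖ ^ 2 = 1 := by
    intro k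
    rw [Finset.sum_eq_single k]
    · simp
    · intro b _ hb
      simp [Pi.single_eq_of_ne hb]
    · simp
  -- Standard unit vectors read off a nonzero entry of `H`.
  refine lt_of_lt_of_le ?_ (h.maximal (Pi.single i 1) (Pi.single j 1) (hunit i) (hunit j))
  simpa using pow_pos (norm_pos_iff.2 hij) 2

/-! ### Link rates and power allocations -/

namespace MmWaveNetwork

variable {N : Type v} {F : Type w} (net : MmWaveNetwork N F)

lemma gain_pos {n m : N} (h : net.links.Adj n m) : 0 < net.gain n m :=
  (net.beamformer n m h).norm_pos (net.H_ne_zero n m h)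

@[simp] lemma linkRate_zero (n m : N) : net.linkRate n m 0 = 0 := by simp [linkRate]

lemma linkRate_mono {n m : N} (h : net.links.Adj n m) {r r' : ℝ} (hr : 0 ≤ r) (hrr : r ≤ r') :
    net.linkRate n m r ≤ net.linkRate n m r' := by
  have h1 := (net.gain_pos h).le
  have h2 := (net.P_pos n).le
  have h3 := (net.g_pos n m h).le
  have h4 := net.W_pos.le
  have h5 := net.N₀_pos.le
  have h6 := net.α₂_pos.le
  have h7 := net.α₁_pos.le
  have h8 := net.Tf_pos.le
  unfold linkRate
  refine mul_le_mul_of_nonneg_left ?_ (by positivity)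
  refine Real.logb_le_logb_of_le (by norm_num) (by positivity) ?_
  gcongr

lemma linkRate_one_pos {n m : N} (h : net.links.Adj n m) : 0 < net.linkRate n m 1 := by
  have h1 := net.gain_pos h
  have h2 := net.P_pos n
  have h3 := net.g_pos n m h
  have h4 := net.W_pos
  have h5 := net.N₀_pos
  have h6 := net.α₂_pos
  have h7 := net.α₁_pos
  have h8 := net.Tf_pos
  unfold linkRate
  refine mul_pos (by positivity) (Real.logb_pos (by norm_num) ?_)
  have : 0 < net.α₂ * ((1 * net.P n) * net.gain n m * net.g n m / (net.W * net.N₀)) := by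
    positivity
  linarith

variable [Fintype N]

/-- A bound for all link rates. -/
noncomputable def rateBound : ℝ := ∑ n, ∑ m, |net.linkRate n m 1|

lemma rateBound_nonneg : 0 ≤ net.rateBound :=
  Finset.sum_nonneg fun _ _ => Finset.sum_nonneg fun _ _ => abs_nonneg _

lemma linkRate_one_le_rateBound (n m : N) : net.linkRate n m 1 ≤ net.rateBound :=
  calc net.linkRate n m 1 ≤ |net.linkRate n m 1| := le_abs_self _
    _ ≤ ∑ m, |net.linkRate n m 1| :=
      Finset.single_le_sum (f := fun m => |net.linkRate n m 1|) (fun _ _ => abs_nonneg _)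
        (Finset.mem_univ m)
    _ ≤ net.rateBound :=
      Finset.single_le_sum (f := fun n => ∑ m, |net.linkRate n m 1|)
        (fun _ _ => Finset.sum_nonneg fun _ _ => abs_nonneg _) (Finset.mem_univ n)

lemma zero_mem_powerSet (s : N → Bool) : (0 : N → N → ℝ) ∈ net.powerSet s := by
  refine ⟨fun _ _ => le_rfl, fun _ _ _ => rfl, fun n m => ?_, fun n => by simp⟩
  cases s n <;> cases s m <;> simp

variable {net}

lemma le_one_of_mem_powerSet {s : N → Bool} {p : N → N → ℝ} (hp : p ∈ net.powerSet s)
    (n m : N) : p n m ≤ 1 :=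
  (Finset.single_le_sum (f := p n) (fun m _ => hp.1 n m) (Finset.mem_univ m)).trans (hp.2.2.2 n)

lemma linkRate_nonneg_of_mem {s : N → Bool} {p : N → N → ℝ} (hp : p ∈ net.powerSet s)
    (n m : N) : 0 ≤ net.linkRate n m (p n m) := by
  by_cases h : net.links.Adj n m
  · simpa using net.linkRate_mono h le_rfl (hp.1 n m)
  · simp [hp.2.1 n m h]

lemma linkRate_le_rateBound {s : N → Bool} {p : N → N → ℝ} (hp : p ∈ net.powerSet s)
    (n m : N) : net.linkRate n m (p n m) ≤ net.rateBound := by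
  by_cases h : net.links.Adj n m
  · exact (net.linkRate_mono h (hp.1 n m) (le_one_of_mem_powerSet hp n m)).trans
      (net.linkRate_one_le_rateBound n m)
  · simpa [hp.2.1 n m h] using net.rateBound_nonneg

/-! ### Back-pressure weights and their Lipschitz dependence on the queues -/

variable [Fintype F]

lemma le_backPressure (q : N → F → ℝ) (n m : N) (f : F) : q n f - q m f ≤ backPressure q n m :=
  le_ciSup (f := fun f => q n f - q m f) (Set.finite_range _).bddAbove f

lemma backPressure_le_add {q q' : N → F → ℝ} {d : ℝ} (hd : 0 ≤ d)
    (h : ∀ n f, |q n f - q' n f| ≤ d) (n m : N) :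
    backPressure q n m ≤ backPressure q' n m + 2 * d := by
  -- Without flows the real supremum takes its default value `0`.
  rcases isEmpty_or_nonempty F with hF | hF
  · simp [backPressure, hd]
  · refine ciSup_le fun f => ?_
    have h1 := abs_le.1 (h n f)
    have h2 := abs_le.1 (h m f)
    linarith [le_backPressure q' n m f, h1.2, h2.1]

variable (net) in
/-- A Lipschitz constant, with respect to the supremum norm, of the back-pressure weights. -/
noncomputable def weightLip : ℝ := ∑ _n : N, ∑ _m : N, net.rateBound * 2

variable (net) in
lemma weightLip_nonneg : 0 ≤ net.weightLip :=
  Finset.sum_nonneg fun _ _ => Finset.sum_nonneg fun _ _ =>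
    mul_nonneg net.rateBound_nonneg zero_le_two

lemma weight_le_add {s : N → Bool} {p : N → N → ℝ} (hp : p ∈ net.powerSet s)
    {q q' : N → F → ℝ} {d : ℝ} (hd : 0 ≤ d) (h : ∀ n f, |q n f - q' n f| ≤ d) :
    net.weight q p ≤ net.weight q' p + net.weightLip * d := by
  simp only [weight, weightLip, Finset.sum_mul, ← Finset.sum_add_distrib]
  refine Finset.sum_le_sum fun n _ => Finset.sum_le_sum fun m _ => ?_
  have h1 := mul_le_mul_of_nonneg_left (backPressure_le_add hd h n m)
    (linkRate_nonneg_of_mem hp n m)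
  have h2 := mul_le_mul_of_nonneg_right (linkRate_le_rateBound hp n m)
    (mul_nonneg zero_le_two hd)
  linarith

lemma backPressure_zero (n m : N) : backPressure (0 : N → F → ℝ) n m = 0 := by
  simp [backPressure]

lemma weight_zero (p : N → N → ℝ) : net.weight 0 p = 0 := by
  simp [weight, backPressure_zero]

lemma abs_sub_zero_le_norm (q : N → F → ℝ) (n : N) (f : F) :
    |q n f - (0 : N → F → ℝ) n f| ≤ ‖q‖ := by
  simpa using (norm_le_pi_norm (q n) f).trans (norm_le_pi_norm q n)

lemma bddAbove_weight (q : N → F → ℝ) (s : N → Bool) :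
    BddAbove (net.weight q '' net.powerSet s) := by
  refine ⟨net.weightLip * ‖q‖, ?_⟩
  rintro _ ⟨p, hp, rfl⟩
  have := weight_le_add hp (norm_nonneg q) (abs_sub_zero_le_norm q)
  rwa [weight_zero, zero_add] at this

lemma weight_le_maxWeight (q : N → F → ℝ) {s : N → Bool} {p : N → N → ℝ}
    (hp : p ∈ net.powerSet s) : net.weight q p ≤ net.maxWeight q s :=
  le_csSup (bddAbove_weight q s) ⟨p, hp, rfl⟩

lemma maxWeight_le {q : N → F → ℝ} {s : N → Bool} {b : ℝ}
    (h : ∀ p ∈ net.powerSet s, net.weight q p ≤ b) : net.maxWeight q s ≤ b := by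
  refine csSup_le ⟨_, 0, net.zero_mem_powerSet s, rfl⟩ ?_
  rintro _ ⟨p, hp, rfl⟩
  exact h p hp

lemma maxWeight_nonneg (q : N → F → ℝ) (s : N → Bool) : 0 ≤ net.maxWeight q s := by
  have := weight_le_maxWeight q (net.zero_mem_powerSet s)
  simpa [weight] using this

lemma maxWeight_le_add {q q' : N → F → ℝ} {d : ℝ} (hd : 0 ≤ d)
    (h : ∀ n f, |q n f - q' n f| ≤ d) (s : N → Bool) :
    net.maxWeight q s ≤ net.maxWeight q' s + net.weightLip * d :=
  maxWeight_le fun p hp => (weight_le_add hp hd h).trans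
    (by linarith [weight_le_maxWeight (net := net) q' hp])

variable (net) in
/-- Largest back-pressure weight over all roles. -/
noncomputable def optWeight (q : N → F → ℝ) : ℝ := ⨆ s, net.maxWeight q s

lemma maxWeight_le_optWeight [DecidableEq N] (q : N → F → ℝ) (s : N → Bool) :
    net.maxWeight q s ≤ net.optWeight q :=
  le_ciSup (Set.finite_range _).bddAbove s

lemma optWeight_nonneg (q : N → F → ℝ) : 0 ≤ net.optWeight q :=
  Real.iSup_nonneg fun s => maxWeight_nonneg q s

lemma optWeight_le {q : N → F → ℝ} {b : ℝ} (h : ∀ s, net.maxWeight q s ≤ b) :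
    net.optWeight q ≤ b := ciSup_le h

lemma exists_maxWeight_eq_optWeight [DecidableEq N] (q : N → F → ℝ) :
    ∃ s, net.maxWeight q s = net.optWeight q :=
  exists_eq_ciSup_of_finite

lemma optWeight_le_add [DecidableEq N] {q q' : N → F → ℝ} {d : ℝ} (hd : 0 ≤ d)
    (h : ∀ n f, |q n f - q' n f| ≤ d) :
    net.optWeight q ≤ net.optWeight q' + net.weightLip * d :=
  optWeight_le fun s => (maxWeight_le_add hd h s).trans
    (by linarith [maxWeight_le_optWeight (net := net) q' s])

lemma optWeight_le_of_abs_le [DecidableEq N] {q : N → F → ℝ} {d : ℝ} (hd : 0 ≤ d)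
    (h : ∀ n f, |q n f| ≤ d) : net.optWeight q ≤ net.weightLip * d := by
  have h0 : net.optWeight (0 : N → F → ℝ) ≤ 0 :=
    optWeight_le fun s => maxWeight_le fun p _ => (weight_zero p).le
  have := optWeight_le_add (net := net) (q := q) (q' := 0) hd (by simpa using h)
  linarith

/-- The supremum runs over uncountably many allocations, so measurability comes from Lipschitz
continuity. -/
lemma measurable_maxWeight (s : N → Bool) :
    Measurable fun q : N → F → ℝ => net.maxWeight q s := by
  refine (LipschitzWith.of_le_add_mul ⟨net.weightLip, net.weightLip_nonneg⟩
    fun q q' => ?_).continuous.measurable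
  refine maxWeight_le_add dist_nonneg (fun n f => ?_) s
  rw [← Real.dist_eq]
  exact (dist_le_pi_dist (q n) (q' n) f).trans (dist_le_pi_dist q q' n)

lemma measurable_optWeight [DecidableEq N] : Measurable fun q : N → F → ℝ => net.optWeight q :=
  Measurable.iSup measurable_maxWeight

/-- No feasible rates do better, as to queue differences, than the largest back-pressure weight;
the rates need not be feasible for the queues that define the weight. -/
lemma FeasibleRates.sum_le_maxWeight {q' : N → F → ℝ} {s : N → Bool} {p : N → N → ℝ}
    {c : N → N → F → ℝ} (hp : p ∈ net.powerSet s) (hc : net.FeasibleRates q' p c)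
    (q : N → F → ℝ) :
    ∑ n, ∑ m, ∑ f, c n m f * (q n f - q m f) ≤ net.maxWeight q s := by
  classical
  -- Links with negative back pressure are switched off: capacity left idle by `c` would otherwise
  -- count negatively in the weight.
  let p' : N → N → ℝ := fun n m => if 0 ≤ backPressure q n m then p n m else 0
  have hle : ∀ n m, p' n m ≤ p n m := fun n m => by
    by_cases h : 0 ≤ backPressure q n m <;> simp [p', h, hp.1 n m]
  have hp' : p' ∈ net.powerSet s := by
    refine ⟨fun n m => ?_, fun n m h => ?_, fun n m => (hle n m).trans (hp.2.2.1 n m),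
      fun n => (Finset.sum_le_sum fun m _ => hle n m).trans (hp.2.2.2 n)⟩
    · by_cases h : 0 ≤ backPressure q n m <;> simp [p', h, hp.1 n m]
    · simp [p', hp.2.1 n m h]
  refine le_trans ?_ (weight_le_maxWeight q hp')
  refine Finset.sum_le_sum fun n _ => Finset.sum_le_sum fun m _ => ?_
  have h1 : ∑ f, c n m f * (q n f - q m f) ≤ (∑ f, c n m f) * backPressure q n m := by
    rw [Finset.sum_mul]
    exact Finset.sum_le_sum fun f _ =>
      mul_le_mul_of_nonneg_left (le_backPressure q n m f) (hc.nonneg n m f)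
  refine h1.trans ?_
  by_cases h : 0 ≤ backPressure q n m
  · simpa [p', h] using mul_le_mul_of_nonneg_right (hc.le_capacity n m) h
  · simpa [p', h] using mul_nonpos_of_nonneg_of_nonpos
      (Finset.sum_nonneg fun f _ => hc.nonneg n m f) (not_le.1 h).le

/-! ### The optimal weight controls the queues that can reach a destination -/

/-- One link used alone at full power. -/
lemma linkRate_mul_sub_le_optWeight [DecidableEq N] (q : N → F → ℝ) {n m : N}
    (h : net.links.Adj n m) (f : F) :
    net.linkRate n m 1 * (q n f - q m f) ≤ net.optWeight q := by
  let s : N → Bool := fun k => decide (k = n)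
  let p : N → N → ℝ := fun k l => if k = n ∧ l = m then 1 else 0
  have hmn : m ≠ n := h.ne'
  have hp : p ∈ net.powerSet s := by
    refine ⟨fun k l => ?_, fun k l hkl => ?_, fun k l => ?_, fun k => ?_⟩
    · by_cases hc : k = n ∧ l = m <;> simp [p, hc]
    · have hc : ¬ (k = n ∧ l = m) := by rintro ⟨rfl, rfl⟩; exact hkl h
      simp [p, hc]
    · by_cases hc : k = n ∧ l = m
      · obtain ⟨rfl, rfl⟩ := hc
        simp [p, s, hmn]
      · simp only [p, hc, if_false]
        cases s k <;> cases s l <;> simp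
    · by_cases hk : k = n <;> simp [p, hk]
  refine le_trans ?_ ((weight_le_maxWeight q hp).trans (maxWeight_le_optWeight q s))
  have hw : net.weight q p = net.linkRate n m 1 * backPressure q n m := by
    unfold weight
    rw [Finset.sum_eq_single n, Finset.sum_eq_single m]
    · simp [p]
    · intro l _ hl; simp [p, hl]
    · simp
    · intro k _ hk; simp [p, hk]
    · simp
  rw [hw]
  exact mul_le_mul_of_nonneg_left (le_backPressure q n m f) (net.linkRate_one_pos h).le

/-- The queue difference telescopes along a path, and each hop, used alone, bounds its own
difference by a multiple of `optWeight`. -/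
lemma exists_sub_le_mul_optWeight [DecidableEq N] {n d : N} (h : net.links.Reachable n d) :
    ∃ M : ℝ, ∀ (q : N → F → ℝ) (f : F), q n f - q d f ≤ M * net.optWeight q := by
  rw [SimpleGraph.reachable_iff_reflTransGen] at h
  induction h with
  | refl => exact ⟨0, fun q f => by simp⟩
  | @tail k l _ hkl ih =>
    obtain ⟨M, hM⟩ := ih
    refine ⟨M + (net.linkRate k l 1)⁻¹, fun q f => ?_⟩
    have h1 := hM q f
    have hpos := net.linkRate_one_pos hkl
    have h2 : q k f - q l f ≤ (net.linkRate k l 1)⁻¹ * net.optWeight q := by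
      rw [inv_mul_eq_div, le_div_iff₀ hpos, mul_comm]
      exact linkRate_mul_sub_le_optWeight q hkl f
    linarith

variable (net) in
/-- Node `n` can send packets of flow `f` to a destination, in several hops. -/
def Served (n : N) (f : F) : Prop := ∃ d ∈ net.dst f, net.links.Reachable n d

open Classical in
variable (net) in
/-- Total number of packets that are not cut off from their destinations. -/
noncomputable def servedBacklog (q : N → F → ℝ) : ℝ :=
  ∑ n, ∑ f, if net.Served n f then q n f else 0

variable (net) in
lemma exists_servedBacklog_le [DecidableEq N] : ∃ M : ℝ, 0 < M ∧ ∀ q : N → F → ℝ,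
    (∀ n f, n ∈ net.dst f → q n f = 0) → net.servedBacklog q ≤ M * net.optWeight q := by
  classical
  have hM : ∀ n f, ∃ M : ℝ, ∀ q : N → F → ℝ, (∀ n f, n ∈ net.dst f → q n f = 0) →
      (if net.Served n f then q n f else 0) ≤ M * net.optWeight q := by
    intro n f
    by_cases h : net.Served n f
    · obtain ⟨d, hd, hnd⟩ := h
      obtain ⟨M, hM⟩ := exists_sub_le_mul_optWeight (F := F) hnd
      refine ⟨M, fun q hq => ?_⟩
      have := hM q f
      rw [hq d f hd, sub_zero] at this
      rwa [if_pos ⟨d, hd, hnd⟩]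
    · exact ⟨0, fun q _ => by simp [h]⟩
  choose M hM using hM
  -- The summand `1` only makes the constant strictly positive, so that the drift can be divided by
  -- it.
  refine ⟨∑ n, ∑ f, |M n f| + 1, by positivity, fun q hq => ?_⟩
  have h0 := optWeight_nonneg (net := net) q
  rw [add_mul, one_mul, Finset.sum_mul]
  refine le_add_of_le_of_nonneg (Finset.sum_le_sum fun n _ => ?_) h0
  rw [Finset.sum_mul]
  exact Finset.sum_le_sum fun f _ => (hM n f q hq).trans
    (mul_le_mul_of_nonneg_right (le_abs_self _) h0)

/-- Queues that are equal at both ends of each link have no back-pressure weight. -/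
lemma optWeight_nonpos {q : N → F → ℝ} (h : ∀ n m f, net.links.Adj n m → q n f = q m f) :
    net.optWeight q ≤ 0 := by
  refine optWeight_le fun s => maxWeight_le fun p hp => ?_
  refine Finset.sum_nonpos fun n _ => Finset.sum_nonpos fun m _ => ?_
  by_cases hnm : net.links.Adj n m
  · refine mul_nonpos_of_nonneg_of_nonpos (linkRate_nonneg_of_mem hp n m) ?_
    exact Real.iSup_nonpos fun f => (sub_eq_zero.2 (h n m f hnm)).le
  · simp [hp.2.1 n m hnm]

/-! ### Loss caused by short queues, and summation by parts -/

/-- The rates of the back-pressure assignment lose a bounded part of the weight, since a link loses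
capacity only if its queue is short. -/
lemma BackPressureRates.weight_le [DecidableEq F] {q : N → F → ℝ} {s : N → Bool} {p : N → N → ℝ}
    {c : N → N → F → ℝ} (hp : p ∈ net.powerSet s) (hq : ∀ n f, 0 ≤ q n f)
    (hc : net.BackPressureRates q p c) :
    net.weight q p ≤ ∑ n, ∑ m, ∑ f, c n m f * (q n f - q m f) +
      ∑ _n : N, ∑ _m : N, net.rateBound * ∑ _k : N, net.rateBound := by
  obtain ⟨fs, hfs, hc⟩ := hc
  simp only [weight, ← Finset.sum_add_distrib]
  refine Finset.sum_le_sum fun n _ => Finset.sum_le_sum fun m _ => ?_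
  have : Nonempty F := ⟨fs n m⟩
  have hbp : backPressure q n m = q n (fs n m) - q m (fs n m) :=
    le_antisymm (ciSup_le fun f => hfs n m f) (le_backPressure q n m _)
  rw [Finset.sum_eq_single (fs n m) (fun f _ hf => by simp [hc n m f, hf]) (by simp), ← hbp,
    hc n m (fs n m), if_pos rfl]
  set l := net.linkRate n m (p n m) with hl
  set S := ∑ m' with fs n m' = fs n m, net.linkRate n m' (p n m') with hS
  have hl0 : 0 ≤ l := linkRate_nonneg_of_mem hp n m
  have hlR : l ≤ net.rateBound := linkRate_le_rateBound hp n m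
  have hS0 : l ≤ S := Finset.single_le_sum (f := fun m' => net.linkRate n m' (p n m'))
    (fun m' _ => linkRate_nonneg_of_mem hp n m') (by simp)
  have hSR : S ≤ ∑ _k : N, net.rateBound :=
    (Finset.sum_le_univ_sum_of_nonneg fun m' => linkRate_nonneg_of_mem hp n m').trans
      (Finset.sum_le_sum fun m' _ => linkRate_le_rateBound hp n m')
  have hR0 := net.rateBound_nonneg
  have hqn := hq n (fs n m)
  have hbq : backPressure q n m ≤ q n (fs n m) := by linarith [hq m (fs n m)]
  have hmin0 : 0 ≤ min l (q n (fs n m) * (l / S)) :=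
    le_min hl0 (mul_nonneg hqn (div_nonneg hl0 (hl0.trans hS0)))
  have hconst : 0 ≤ net.rateBound * ∑ _k : N, net.rateBound :=
    mul_nonneg hR0 (Finset.sum_nonneg fun _ _ => hR0)
  -- If the queue covers the total capacity `S` assigned to its flow, the link works at full rate.
  -- Otherwise the back pressure is at most the queue, hence below `S`, and the lost product is
  -- bounded.
  rcases le_or_gt S (q n (fs n m)) with hlong | hshort
  · have : l ≤ q n (fs n m) * (l / S) := by
      rcases hl0.eq_or_lt with h0 | h0
      · simp [← h0]
      · rw [mul_div_assoc', le_div_iff₀ (h0.trans_le hS0), mul_comm]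
        exact mul_le_mul_of_nonneg_right hlong hl0
    rw [min_eq_left this]
    linarith
  · have hmin1 : min l (q n (fs n m) * (l / S)) ≤ l := min_le_left _ _
    have h1 : (l - min l (q n (fs n m) * (l / S))) * backPressure q n m ≤
        (l - min l (q n (fs n m) * (l / S))) * ∑ _k : N, net.rateBound :=
      mul_le_mul_of_nonneg_left (by linarith) (by linarith)
    have h2 : (l - min l (q n (fs n m) * (l / S))) * ∑ _k : N, net.rateBound ≤
        net.rateBound * ∑ _k : N, net.rateBound :=
      mul_le_mul_of_nonneg_right (by linarith) (Finset.sum_nonneg fun _ _ => hR0)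
    linarith

/-- Summation by parts on the network. -/
lemma sum_mul_inflow_sub_outflow (y : N → F → ℝ) (c : N → N → F → ℝ) :
    ∑ n, ∑ f, y n f * ∑ m, (c m n f - c n m f) =
      -∑ n, ∑ m, ∑ f, c n m f * (y n f - y m f) := by
  have h1 : ∑ n, ∑ f, y n f * ∑ m, (c m n f - c n m f) =
      ∑ n, ∑ m, ∑ f, c m n f * y n f - ∑ n, ∑ m, ∑ f, c n m f * y n f := by
    rw [← Finset.sum_sub_distrib]
    refine Finset.sum_congr rfl fun n _ => ?_
    rw [← Finset.sum_sub_distrib, Finset.sum_congr rfl fun f _ => Finset.mul_sum _ _ _,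
      Finset.sum_comm]
    refine Finset.sum_congr rfl fun m _ => ?_
    rw [← Finset.sum_sub_distrib]
    exact Finset.sum_congr rfl fun f _ => by ring
  rw [h1, Finset.sum_comm (f := fun n m => ∑ f, c m n f * y n f), ← Finset.sum_sub_distrib,
    ← Finset.sum_neg_distrib]
  refine Finset.sum_congr rfl fun n _ => ?_
  rw [← Finset.sum_sub_distrib, ← Finset.sum_neg_distrib]
  refine Finset.sum_congr rfl fun m _ => ?_
  rw [← Finset.sum_sub_distrib, ← Finset.sum_neg_distrib]
  exact Finset.sum_congr rfl fun f _ => by ring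

end MmWaveNetwork

lemma integrable_of_abs_le {Ω : Type*} [MeasurableSpace Ω] {μ : Measure Ω} [IsFiniteMeasure μ]
    {f : Ω → ℝ} (hf : Measurable f) {C : ℝ} (hC : ∀ ω, |f ω| ≤ C) : Integrable f μ :=
  Integrable.of_bound hf.aestronglyMeasurable C (ae_of_all _ hC)

lemma integral_mul_of_indep {Ω : Type*} {m₁ m₂ m₀ : MeasurableSpace Ω} {μ : Measure Ω}
    (h : Indep m₁ m₂ μ) (h₁ : m₁ ≤ m₀) (h₂ : m₂ ≤ m₀) {X Y : Ω → ℝ} (hX : Measurable[m₁] X)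
    (hY : Measurable[m₂] Y) : ∫ ω, X ω * Y ω ∂μ = (∫ ω, X ω ∂μ) * ∫ ω, Y ω ∂μ := by
  have hind : IndepFun X Y μ := by
    rw [IndepFun_iff_Indep]
    exact indep_of_indep_of_le_left (indep_of_indep_of_le_right h hY.comap_le) hX.comap_le
  exact hind.integral_fun_mul_eq_mul_integral (hX.mono h₁ le_rfl).aestronglyMeasurable
    (hY.mono h₂ le_rfl).aestronglyMeasurable

/-! ### Bounds and measurability along an evolution -/

namespace MmWaveNetwork

variable {N : Type v} {F : Type w} [Fintype N] [Fintype F] [DecidableEq N]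
  {net : MmWaveNetwork N F}

namespace Evolution

variable (E : Evolution.{u, v, w} net)

lemma q_eq_zero_of_mem_dst (t : ℕ) (ω : E.Ω) {n : N} {f : F} (h : n ∈ net.dst f) :
    E.q t ω n f = 0 := by
  cases t with
  | zero => rw [E.q_zero, E.q₀_dst n f h]
  | succ t => rw [E.q_succ, if_pos h]

lemma q_nonneg (t : ℕ) (ω : E.Ω) (n : N) (f : F) : 0 ≤ E.q t ω n f := by
  cases t with
  | zero => rw [E.q_zero]; exact E.q₀_nonneg n f
  | succ t =>
    rw [E.q_succ]
    split_ifs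
    · rfl
    · rw [Finset.sum_sub_distrib]
      have h1 := (E.c_feasible t ω).le_queue n f
      have h2 : 0 ≤ ∑ m, E.c t ω m n f :=
        Finset.sum_nonneg fun m _ => (E.c_feasible t ω).nonneg m n f
      linarith [E.a_nonneg t ω n f]

lemma c_le_rateBound (t : ℕ) (ω : E.Ω) (n m : N) (f : F) : E.c t ω n m f ≤ net.rateBound :=
  calc E.c t ω n m f ≤ ∑ f, E.c t ω n m f :=
        Finset.single_le_sum (f := fun f => E.c t ω n m f)
          (fun f _ => (E.c_feasible t ω).nonneg n m f) (Finset.mem_univ f)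
    _ ≤ _ := (E.c_feasible t ω).le_capacity n m
    _ ≤ _ := linkRate_le_rateBound (E.p_mem t ω) n m

lemma exists_increment_bound : ∃ D : ℝ, 0 ≤ D ∧ ∀ t ω n f,
    |∑ m, (E.c t ω m n f - E.c t ω n m f) + E.a t ω n f| ≤ D := by
  obtain ⟨A, hA⟩ := E.a_bounded
  have hR := net.rateBound_nonneg
  refine ⟨∑ _m : N, net.rateBound + |A|, by positivity, fun t ω n f => ?_⟩
  refine (abs_add_le _ _).trans (add_le_add ((Finset.abs_sum_le_sum_abs _ _).trans
    (Finset.sum_le_sum fun m _ => ?_)) ?_)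
  · have h1 := (E.c_feasible t ω).nonneg m n f
    have h2 := (E.c_feasible t ω).nonneg n m f
    have h3 := E.c_le_rateBound t ω m n f
    have h4 := E.c_le_rateBound t ω n m f
    exact abs_le.2 ⟨by linarith, by linarith⟩
  · rw [abs_of_nonneg (E.a_nonneg t ω n f)]
    exact (hA t ω n f).trans (le_abs_self A)

lemma abs_q_succ_sub_le {D : ℝ} (hD0 : 0 ≤ D)
    (hD : ∀ t ω n f, |∑ m, (E.c t ω m n f - E.c t ω n m f) + E.a t ω n f| ≤ D)
    (t : ℕ) (ω : E.Ω) (n : N) (f : F) : |E.q (t + 1) ω n f - E.q t ω n f| ≤ D := by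
  by_cases h : n ∈ net.dst f
  · simpa [E.q_eq_zero_of_mem_dst _ ω h] using hD0
  · rw [E.q_succ, if_neg h]
    convert hD t ω n f using 2
    ring

/-- The bound grows with `t`; it serves integrability only. -/
lemma exists_q_le (t : ℕ) : ∃ C : ℝ, 0 ≤ C ∧ ∀ ω n f, |E.q t ω n f| ≤ C := by
  obtain ⟨D, hD0, hD⟩ := E.exists_increment_bound
  induction t with
  | zero =>
    refine ⟨‖E.q₀‖, norm_nonneg _, fun ω n f => ?_⟩
    rw [E.q_zero]
    exact (norm_le_pi_norm (E.q₀ n) f).trans (norm_le_pi_norm E.q₀ n)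
  | succ t ih =>
    obtain ⟨C, hC0, hC⟩ := ih
    refine ⟨C + D, add_nonneg hC0 hD0, fun ω n f => ?_⟩
    have h1 := abs_le.1 (hC ω n f)
    have h2 := abs_le.1 (E.abs_q_succ_sub_le hD0 hD t ω n f)
    exact abs_le.2 ⟨by linarith, by linarith⟩

lemma measurable_a_apply (t : ℕ) (n : N) (f : F) :
    Measurable[E.ℱ (t + 1)] fun ω => E.a t ω n f :=
  (measurable_pi_apply f).comp ((measurable_pi_apply n).comp (E.a_measurable t))

lemma measurable_c_apply (t : ℕ) (n m : N) (f : F) :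
    Measurable[E.ℱ t] fun ω => E.c t ω n m f :=
  (measurable_pi_apply f).comp
    ((measurable_pi_apply m).comp ((measurable_pi_apply n).comp (E.c_measurable t)))

lemma measurable_q_apply (t : ℕ) (n : N) (f : F) :
    Measurable[E.ℱ t] fun ω => E.q t ω n f := by
  induction t generalizing n f with
  | zero => simp only [E.q_zero]; exact measurable_const
  | succ t ih =>
    have hle : E.ℱ t ≤ E.ℱ (t + 1) := E.ℱ.mono t.le_succ
    simp only [E.q_succ]
    by_cases h : n ∈ net.dst f
    · simp only [h, if_true]; exact measurable_const
    · simp only [h, if_false]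
      exact (((ih n f).mono hle le_rfl).add (Finset.measurable_sum _ fun m _ =>
        ((E.measurable_c_apply t m n f).mono hle le_rfl).sub
          ((E.measurable_c_apply t n m f).mono hle le_rfl))).add (E.measurable_a_apply t n f)

lemma measurable_q (t : ℕ) : Measurable[E.ℱ t] (E.q t) :=
  @measurable_pi_lambda _ _ _ (E.ℱ t) _ _ fun n =>
    @measurable_pi_lambda _ _ _ (E.ℱ t) _ _ fun f => E.measurable_q_apply t n f

lemma integrable_a (t : ℕ) (n : N) (f : F) : Integrable (fun ω => E.a t ω n f) E.μ := by
  obtain ⟨A, hA⟩ := E.a_bounded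
  refine integrable_of_abs_le ((E.measurable_a_apply t n f).mono (E.ℱ.le _) le_rfl)
    (C := A) fun ω => ?_
  rw [abs_of_nonneg (E.a_nonneg t ω n f)]
  exact hA t ω n f

lemma integrable_q (t : ℕ) (n : N) (f : F) : Integrable (fun ω => E.q t ω n f) E.μ := by
  obtain ⟨C, _, hC⟩ := E.exists_q_le t
  exact integrable_of_abs_le ((E.measurable_q_apply t n f).mono (E.ℱ.le _) le_rfl)
    fun ω => hC ω n f

lemma integrable_backlog (t : ℕ) : Integrable (E.backlog t) E.μ :=
  integrable_finsetSum _ fun n _ => integrable_finsetSum _ fun f _ => E.integrable_q t n f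

lemma backlog_nonneg (t : ℕ) (ω : E.Ω) : 0 ≤ E.backlog t ω :=
  Finset.sum_nonneg fun n _ => Finset.sum_nonneg fun f _ => E.q_nonneg t ω n f

/-! ### Outer bound for the capacity region -/

/-- Evolution of a linear functional of the queues that ignores the destinations. -/
lemma sum_mul_q_succ {y : N → F → ℝ} (hy : ∀ n f, n ∈ net.dst f → y n f = 0)
    (t : ℕ) (ω : E.Ω) :
    ∑ n, ∑ f, y n f * E.q (t + 1) ω n f = ∑ n, ∑ f, y n f * E.q t ω n f +
      ∑ n, ∑ f, y n f * E.a t ω n f -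
      ∑ n, ∑ m, ∑ f, E.c t ω n m f * (y n f - y m f) := by
  rw [sub_eq_add_neg, ← sum_mul_inflow_sub_outflow]
  simp only [← Finset.sum_add_distrib]
  refine Finset.sum_congr rfl fun n _ => Finset.sum_congr rfl fun f _ => ?_
  rw [E.q_succ]
  by_cases h : n ∈ net.dst f
  · simp [hy n f h]
  · rw [if_neg h]; ring

/-- In each frame the transmissions lower `y·q` by at most `optWeight y`, whatever the policy; what
has arrived and not been removed is still queued. -/
lemma sum_arrivals_le {y : N → F → ℝ} (hy0 : ∀ n f, 0 ≤ y n f)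
    (hy : ∀ n f, n ∈ net.dst f → y n f = 0) (T : ℕ) (ω : E.Ω) :
    ∑ t ∈ Finset.range T, ∑ n, ∑ f, y n f * E.a t ω n f ≤
      ∑ n, ∑ f, y n f * E.q T ω n f + T * net.optWeight y := by
  induction T with
  | zero =>
    simpa using Finset.sum_nonneg fun n _ => Finset.sum_nonneg fun f _ =>
      mul_nonneg (hy0 n f) (E.q_nonneg 0 ω n f)
  | succ T ih =>
    rw [Finset.sum_range_succ, E.sum_mul_q_succ hy]
    have h1 := (E.c_feasible T ω).sum_le_maxWeight (E.p_mem T ω) y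
    have h2 := maxWeight_le_optWeight (net := net) y (E.s T ω)
    push_cast
    linarith

lemma sum_mul_q_le_backlog {y : N → F → ℝ} (hy0 : ∀ n f, 0 ≤ y n f) (t : ℕ) (ω : E.Ω) :
    ∑ n, ∑ f, y n f * E.q t ω n f ≤ (∑ n, ∑ f, y n f) * E.backlog t ω := by
  simp only [backlog, Finset.mul_sum]
  refine Finset.sum_le_sum fun n _ => Finset.sum_le_sum fun f _ =>
    mul_le_mul_of_nonneg_right ?_ (E.q_nonneg t ω n f)
  exact (Finset.single_le_sum (f := y n) (fun f _ => hy0 n f) (Finset.mem_univ f)).trans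
    (Finset.single_le_sum (f := fun n => ∑ f, y n f)
      (fun n _ => Finset.sum_nonneg fun f _ => hy0 n f) (Finset.mem_univ n))

lemma sum_mean_arrivals_le {y : N → F → ℝ} (hy0 : ∀ n f, 0 ≤ y n f)
    (hy : ∀ n f, n ∈ net.dst f → y n f = 0) (T : ℕ) :
    ∑ n, ∑ f, y n f * ∑ t ∈ Finset.range T, ∫ ω, E.a t ω n f ∂E.μ ≤
      (∑ n, ∑ f, y n f) * ∫ ω, E.backlog T ω ∂E.μ + T * net.optWeight y := by
  have h1 : ∑ n, ∑ f, y n f * ∑ t ∈ Finset.range T, ∫ ω, E.a t ω n f ∂E.μ =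
      ∫ ω, ∑ t ∈ Finset.range T, ∑ n, ∑ f, y n f * E.a t ω n f ∂E.μ := by
    rw [integral_finsetSum _ fun t _ => integrable_finsetSum _ fun n _ =>
      integrable_finsetSum _ fun f _ => (E.integrable_a t n f).const_mul _]
    simp only [Finset.mul_sum]
    rw [Finset.sum_congr rfl fun n _ => Finset.sum_comm, Finset.sum_comm]
    refine Finset.sum_congr rfl fun t _ => ?_
    rw [integral_finsetSum _ fun n _ =>
      integrable_finsetSum _ fun f _ => (E.integrable_a t n f).const_mul _]
    refine Finset.sum_congr rfl fun n _ => ?_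
    rw [integral_finsetSum _ fun f _ => (E.integrable_a t n f).const_mul _]
    exact Finset.sum_congr rfl fun f _ => (integral_const_mul _ _).symm
  have h2 : (∑ n, ∑ f, y n f) * ∫ ω, E.backlog T ω ∂E.μ + T * net.optWeight y =
      ∫ ω, ((∑ n, ∑ f, y n f) * E.backlog T ω + T * net.optWeight y) ∂E.μ := by
    rw [integral_add ((E.integrable_backlog T).const_mul _) (integrable_const _),
      integral_const_mul]
    simp
  rw [h1, h2]
  refine integral_mono (integrable_finsetSum _ fun t _ => integrable_finsetSum _ fun n _ =>
    integrable_finsetSum _ fun f _ => (E.integrable_a t n f).const_mul _)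
    (((E.integrable_backlog T).const_mul _).add (integrable_const _)) fun ω => ?_
  exact (E.sum_arrivals_le hy0 hy T ω).trans
    (add_le_add_left (E.sum_mul_q_le_backlog hy0 T ω) _)

/-- If the mean exceeded `2 * B` from some time `a` on, the second half of a window of `2 * (a + 1)`
frames would alone push the average above `B`. -/
lemma frequently_mean_backlog_le {B : ℝ}
    (hB : ∀ T : ℕ, 0 < T → (∑ t ∈ Finset.range T, ∫ ω, E.backlog t ω ∂E.μ) / T ≤ B) :
    ∃ᶠ T : ℕ in atTop, 0 < T ∧ ∫ ω, E.backlog T ω ∂E.μ ≤ 2 * B := by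
  rw [frequently_atTop]
  intro a
  by_contra! hc
  have h0 : ∀ t, 0 ≤ ∫ ω, E.backlog t ω ∂E.μ := fun t => integral_nonneg (E.backlog_nonneg t)
  have h1 := hB ((a + 1) + (a + 1)) (by omega)
  rw [Finset.sum_range_add, div_le_iff₀ (by positivity)] at h1
  have h2 : ∑ i ∈ Finset.range (a + 1), 2 * B <
      ∑ i ∈ Finset.range (a + 1), ∫ ω, E.backlog (a + 1 + i) ω ∂E.μ :=
    Finset.sum_lt_sum_of_nonempty (by simp) fun i _ => hc _ (by omega) (by omega)
  have h3 : 0 ≤ ∑ t ∈ Finset.range (a + 1), ∫ ω, E.backlog t ω ∂E.μ :=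
    Finset.sum_nonneg fun t _ => h0 t
  simp only [Finset.sum_const, Finset.card_range, nsmul_eq_mul] at h2
  push_cast at h1 h2
  linarith

end Evolution

/-- Rate vectors of the capacity region are dominated, in each direction, by the largest
back-pressure weight. -/
lemma sum_mul_le_optWeight {x : N → F → ℝ} (hx : x ∈ net.capacityRegion) {y : N → F → ℝ}
    (hy0 : ∀ n f, 0 ≤ y n f) (hy : ∀ n f, n ∈ net.dst f → y n f = 0) :
    ∑ n, ∑ f, y n f * x n f ≤ net.optWeight y := by
  obtain ⟨E, hE, -, B, hB⟩ := hx
  have h1 : Tendsto (fun T : ℕ => ∑ n, ∑ f,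
      y n f * ((∑ t ∈ Finset.range T, ∫ ω, E.a t ω n f ∂E.μ) / T)) atTop
      (𝓝 (∑ n, ∑ f, y n f * x n f)) :=
    tendsto_finsetSum _ fun n _ => tendsto_finsetSum _ fun f _ => (hE n f).const_mul _
  have h2 := h1.sub (tendsto_const_div_atTop_nhds_zero_nat ((∑ n, ∑ f, y n f) * (2 * B)))
  rw [sub_zero] at h2
  -- Stability controls the mean backlog only for infinitely many `T`; this suffices because the
  -- limit exists.
  refine le_of_tendsto_of_frequently h2 ((E.frequently_mean_backlog_le hB).mono ?_)
  rintro T ⟨hT, hTB⟩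
  have hT' : (0 : ℝ) < T := by exact_mod_cast hT
  have h3 := E.sum_mean_arrivals_le hy0 hy T
  have h4 : (∑ n, ∑ f, y n f) * ∫ ω, E.backlog T ω ∂E.μ ≤ (∑ n, ∑ f, y n f) * (2 * B) :=
    mul_le_mul_of_nonneg_left hTB
      (Finset.sum_nonneg fun n _ => Finset.sum_nonneg fun f _ => hy0 n f)
  simp only [mul_div_assoc', ← Finset.sum_div]
  rw [← sub_div, div_le_iff₀ hT']
  linarith

lemma nonneg_of_mem_capacityRegion {x : N → F → ℝ} (hx : x ∈ net.capacityRegion) (n : N) (f : F) :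
    0 ≤ x n f := by
  obtain ⟨E, hE, -⟩ := hx
  exact ge_of_tendsto' (hE n f) fun T => div_nonneg
    (Finset.sum_nonneg fun t _ => integral_nonneg fun ω => E.a_nonneg t ω n f) T.cast_nonneg

/-- Traffic that cannot reach its destinations has no positive rate in the capacity region. -/
lemma nonpos_of_not_served {x : N → F → ℝ} (hx : x ∈ net.capacityRegion) {n : N} {f : F}
    (h : ¬ net.Served n f) : x n f ≤ 0 := by
  classical
  -- The indicator of the component of `n`, for flow `f` alone. It vanishes at destinations because
  -- the component contains none, and it is constant along links, so its weight is zero.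
  let y : N → F → ℝ := fun k f' => if f' = f ∧ net.links.Reachable n k then 1 else 0
  have hy0 : ∀ k f', 0 ≤ y k f' := fun k f' => by dsimp only [y]; split_ifs <;> norm_num
  have hyd : ∀ k f', k ∈ net.dst f' → y k f' = 0 := fun k f' hk => by
    refine if_neg ?_
    rintro ⟨rfl, hnk⟩
    exact h ⟨k, hk, hnk⟩
  have hadj : ∀ k m f', net.links.Adj k m → y k f' = y m f' := fun k m f' hkm => by
    have : net.links.Reachable n k ↔ net.links.Reachable n m :=
      ⟨fun h => h.trans hkm.reachable, fun h => h.trans hkm.symm.reachable⟩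
    simp only [y, this]
  have h1 : ∀ k f', 0 ≤ y k f' * x k f' := fun k f' =>
    mul_nonneg (hy0 k f') (nonneg_of_mem_capacityRegion hx k f')
  calc x n f = y n f * x n f := by simp [y]
    _ ≤ ∑ f', y n f' * x n f' :=
      Finset.single_le_sum (f := fun f' => y n f' * x n f') (fun f' _ => h1 n f')
        (Finset.mem_univ f)
    _ ≤ ∑ k, ∑ f', y k f' * x k f' :=
      Finset.single_le_sum (f := fun k => ∑ f', y k f' * x k f')
        (fun k _ => Finset.sum_nonneg fun f' _ => h1 k f') (Finset.mem_univ n)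
    _ ≤ net.optWeight y := sum_mul_le_optWeight hx hy0 hyd
    _ ≤ 0 := optWeight_nonpos hadj

end MmWaveNetwork

/-! ### Foster–Lyapunov criteria, with integrals over past events in place of conditional
expectations -/

lemma setIntegral_mul_of_indep {Ω : Type*} {m₁ m₂ m₀ : MeasurableSpace Ω} {μ : Measure Ω}
    (h : Indep m₁ m₂ μ) (h₁ : m₁ ≤ m₀) (h₂ : m₂ ≤ m₀) {X Y : Ω → ℝ} (hX : Measurable[m₁] X)
    (hY : Measurable[m₂] Y) {A : Set Ω} (hA : MeasurableSet[m₁] A) :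
    ∫ ω in A, X ω * Y ω ∂μ = (∫ ω in A, X ω ∂μ) * ∫ ω, Y ω ∂μ := by
  rw [← integral_indicator (h₁ A hA), ← integral_indicator (h₁ A hA),
    ← integral_mul_of_indep h h₁ h₂ (hX.indicator hA) hY]
  congr 1 with ω
  by_cases hω : ω ∈ A <;> simp [hω]

section Foster

variable {Ω : Type*} {m₀ : MeasurableSpace Ω} {μ : Measure Ω} [IsProbabilityMeasure μ]
  {ℱ : Filtration ℕ m₀} {V U : ℕ → Ω → ℝ} {b ε : ℝ}

/-- Foster–Lyapunov criterion, recurrence: if `V` is nonnegative and has drift at most `b - ε U`,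
then almost surely `U` returns again and again below a fixed level. -/
lemma ae_frequently_le_of_drift (hU : ∀ t, Measurable[ℱ t] (U t))
    (hUi : ∀ t, Integrable (U t) μ) (hVi : ∀ t, Integrable (V t) μ) (hV : ∀ t ω, 0 ≤ V t ω)
    (hε : 0 < ε)
    (h : ∀ t A, MeasurableSet[ℱ t] A →
      ∫ ω in A, V (t + 1) ω ∂μ ≤ ∫ ω in A, (V t ω + (b - ε * U t ω)) ∂μ) :
    ∀ᵐ ω ∂μ, ∃ᶠ t in atTop, U t ω ≤ (b + 1) / ε := by
  set B := (b + 1) / ε with hB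
  have key : ∀ t₀, μ {ω | ∀ j, B < U (t₀ + j) ω} = 0 := by
    intro t₀
    let A : ℕ → Set Ω := fun k => {ω | ∀ j ≤ k, B < U (t₀ + j) ω}
    have hA : ∀ k, MeasurableSet[ℱ (t₀ + k)] (A k) := by
      intro k
      have : A k = ⋂ j ∈ Finset.range (k + 1), U (t₀ + j) ⁻¹' Set.Ioi B := by
        ext ω
        simp [A]
      rw [this]
      refine Finset.measurableSet_biInter _ fun j hj => ?_
      exact ℱ.mono (by simp at hj; omega) _ (hU (t₀ + j) measurableSet_Ioi)
    have hA' : ∀ k, MeasurableSet (A k) := fun k => ℱ.le _ _ (hA k)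
    set D : Set Ω := {ω | ∀ j, B < U (t₀ + j) ω} with hD
    have hDA : ∀ k, D ⊆ A k := fun k ω hω j _ => hω j
    -- While `U` stays above `B`, the drift is at most `-1`, so each step costs at least the measure
    -- of `D`. As `V ≥ 0`, this can go on forever only if `D` is null.
    have hstep : ∀ k, ∫ ω in A (k + 1), V (t₀ + (k + 1)) ω ∂μ + μ.real D ≤
        ∫ ω in A k, V (t₀ + k) ω ∂μ := by
      intro k
      have h1 : ∫ ω in A (k + 1), V (t₀ + (k + 1)) ω ∂μ ≤
          ∫ ω in A k, V (t₀ + k + 1) ω ∂μ :=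
        setIntegral_mono_set (hVi _).integrableOn (ae_of_all _ fun ω => hV _ ω)
          (LE.le.eventuallyLE fun ω hω j hj => hω j (hj.trans k.le_succ))
      have h2 : ∫ ω in A k, (V (t₀ + k) ω + (b - ε * U (t₀ + k) ω)) ∂μ ≤
          ∫ ω in A k, (V (t₀ + k) ω - 1) ∂μ := by
        refine setIntegral_mono_on ((hVi _).add
          ((integrable_const _).sub ((hUi _).const_mul _))).integrableOn
          ((hVi _).sub (integrable_const _)).integrableOn (hA' k) fun ω hω => ?_
        have h3 := hω k le_rfl
        rw [hB, div_lt_iff₀ hε] at h3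
        linarith
      have h4 : ∫ ω in A k, (V (t₀ + k) ω - 1) ∂μ =
          ∫ ω in A k, V (t₀ + k) ω ∂μ - μ.real (A k) := by
        rw [integral_sub (hVi _).integrableOn (integrable_const _)]
        simp
      have h5 : μ.real D ≤ μ.real (A k) := measureReal_mono (hDA k)
      linarith [h (t₀ + k) (A k) (hA k)]
    have hsum : ∀ k : ℕ, k * μ.real D ≤ ∫ ω in A 0, V (t₀ + 0) ω ∂μ := by
      have : ∀ k : ℕ, ∫ ω in A k, V (t₀ + k) ω ∂μ + k * μ.real D ≤
          ∫ ω in A 0, V (t₀ + 0) ω ∂μ := by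
        intro k
        induction k with
        | zero => simp
        | succ k ih =>
          push_cast
          linarith [hstep k]
      intro k
      have h0 : 0 ≤ ∫ ω in A k, V (t₀ + k) ω ∂μ := integral_nonneg fun ω => hV _ ω
      linarith [this k]
    by_contra hne
    have hpos : 0 < μ.real D := ENNReal.toReal_pos hne (measure_ne_top _ _)
    obtain ⟨k, hk⟩ := exists_nat_gt ((∫ ω in A 0, V (t₀ + 0) ω ∂μ) / μ.real D)
    rw [div_lt_iff₀ hpos] at hk
    linarith [hsum k]
  have hall : ∀ᵐ ω ∂μ, ∀ t₀, ¬ ∀ j, B < U (t₀ + j) ω :=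
    ae_all_iff.2 fun t₀ => measure_eq_zero_iff_ae_notMem.1 (key t₀)
  filter_upwards [hall] with ω hω
  rw [frequently_atTop]
  intro t₀
  obtain ⟨j, hj⟩ := not_forall.1 (hω t₀)
  exact ⟨t₀ + j, by omega, not_lt.1 hj⟩

/-- Foster–Lyapunov criterion, time averages. -/
lemma sum_integral_div_le_of_drift
    (hUi : ∀ t, Integrable (U t) μ) (hVi : ∀ t, Integrable (V t) μ) (hV : ∀ t ω, 0 ≤ V t ω)
    (hε : 0 < ε)
    (h : ∀ t A, MeasurableSet[ℱ t] A →
      ∫ ω in A, V (t + 1) ω ∂μ ≤ ∫ ω in A, (V t ω + (b - ε * U t ω)) ∂μ)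
    {T : ℕ} (hT : 0 < T) :
    (∑ t ∈ Finset.range T, ∫ ω, U t ω ∂μ) / T ≤ (∫ ω, V 0 ω ∂μ + b) / ε := by
  have hstep : ∀ t, ∫ ω, V (t + 1) ω ∂μ + ε * ∫ ω, U t ω ∂μ ≤ ∫ ω, V t ω ∂μ + b := by
    intro t
    have h1 := h t Set.univ MeasurableSet.univ
    simp only [setIntegral_univ] at h1
    have h2 : Integrable (fun ω => b - ε * U t ω) μ :=
      (integrable_const _).sub ((hUi t).const_mul _)
    rw [integral_add (hVi t) h2,
      integral_sub (integrable_const _) ((hUi t).const_mul _), integral_const_mul] at h1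
    simp only [integral_const, probReal_univ, one_smul] at h1
    linarith
  have hsum : ∀ T : ℕ, ∫ ω, V T ω ∂μ + ε * ∑ t ∈ Finset.range T, ∫ ω, U t ω ∂μ ≤
      ∫ ω, V 0 ω ∂μ + T * b := by
    intro T
    induction T with
    | zero => simp
    | succ T ih =>
      rw [Finset.sum_range_succ]
      push_cast
      linarith [hstep T]
  have h0 : 0 ≤ ∫ ω, V 0 ω ∂μ := integral_nonneg (hV 0)
  have hTV : 0 ≤ ∫ ω, V T ω ∂μ := integral_nonneg (hV T)
  have hT1 : (1 : ℝ) ≤ T := by exact_mod_cast hT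
  rw [div_le_div_iff₀ (by linarith) hε]
  have h2 : ∫ ω, V 0 ω ∂μ ≤ (∫ ω, V 0 ω ∂μ) * T := le_mul_of_one_le_right h0 hT1
  linarith [hsum T]

end Foster

/-! ### Drift of the gap and of the energy -/

namespace MmWaveNetwork

variable {N : Type v} {F : Type w} [Fintype N] [Fintype F] [DecidableEq N]
  {net : MmWaveNetwork N F}

namespace Evolution

variable (E : Evolution.{u, v, w} net)

lemma measurable_maxWeight_q (t : ℕ) (r : N → Bool) :
    Measurable[E.ℱ t] fun ω => net.maxWeight (E.q t ω) r :=
  (measurable_maxWeight r).comp (E.measurable_q t)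

lemma measurable_optWeight_q (t : ℕ) : Measurable[E.ℱ t] fun ω => net.optWeight (E.q t ω) :=
  measurable_optWeight.comp (E.measurable_q t)

lemma measurable_maxWeight_q_s (t : ℕ) :
    Measurable[E.ℱ t] fun ω => net.maxWeight (E.q t ω) (E.s t ω) := by
  classical
  have h : (fun ω => net.maxWeight (E.q t ω) (E.s t ω)) = fun ω =>
      ∑ r, if E.s t ω = r then net.maxWeight (E.q t ω) r else 0 := by
    funext ω
    simp
  rw [h]
  exact Finset.measurable_sum _ fun r _ => Measurable.ite
    (E.s_measurable t (measurableSet_singleton r))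
    ((measurable_maxWeight r).comp (E.measurable_q t)) measurable_const

/-- What the roles in use lose, compared with the best ones. -/
noncomputable def gap (t : ℕ) (ω : E.Ω) : ℝ :=
  net.optWeight (E.q t ω) - net.maxWeight (E.q t ω) (E.s t ω)

lemma gap_nonneg (t : ℕ) (ω : E.Ω) : 0 ≤ E.gap t ω :=
  sub_nonneg.2 (maxWeight_le_optWeight _ _)

lemma measurable_gap (t : ℕ) : Measurable[E.ℱ t] (E.gap t) :=
  (E.measurable_optWeight_q t).sub (E.measurable_maxWeight_q_s t)

lemma exists_optWeight_q_le (t : ℕ) : ∃ C : ℝ, ∀ ω, net.optWeight (E.q t ω) ≤ C := by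
  obtain ⟨C, hC0, hC⟩ := E.exists_q_le t
  exact ⟨_, fun ω => optWeight_le_of_abs_le hC0 (hC ω)⟩

lemma integrable_optWeight_q (t : ℕ) : Integrable (fun ω => net.optWeight (E.q t ω)) E.μ := by
  obtain ⟨C, hC⟩ := E.exists_optWeight_q_le t
  refine integrable_of_abs_le ((E.measurable_optWeight_q t).mono (E.ℱ.le t) le_rfl)
    (C := C) fun ω => ?_
  rw [abs_of_nonneg (optWeight_nonneg _)]
  exact hC ω

lemma exists_gap_le (t : ℕ) : ∃ C : ℝ, ∀ ω, E.gap t ω ≤ C := by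
  obtain ⟨C, hC⟩ := E.exists_optWeight_q_le t
  exact ⟨C, fun ω => (sub_le_self _ (maxWeight_nonneg _ _)).trans (hC ω)⟩

lemma integrable_gap (t : ℕ) : Integrable (E.gap t) E.μ := by
  obtain ⟨C, hC⟩ := E.exists_gap_le t
  refine integrable_of_abs_le ((E.measurable_gap t).mono (E.ℱ.le t) le_rfl)
    (C := C) fun ω => ?_
  rw [abs_of_nonneg (E.gap_nonneg t ω)]
  exact hC ω

/-- Sum of the squared queue lengths. -/
noncomputable def energy (t : ℕ) (ω : E.Ω) : ℝ := ∑ n, ∑ f, E.q t ω n f ^ 2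

lemma energy_nonneg (t : ℕ) (ω : E.Ω) : 0 ≤ E.energy t ω :=
  Finset.sum_nonneg fun _ _ => Finset.sum_nonneg fun _ _ => sq_nonneg _

lemma integrable_energy (t : ℕ) : Integrable (E.energy t) E.μ := by
  obtain ⟨C, hC0, hC⟩ := E.exists_q_le t
  refine integrable_finsetSum _ fun n _ => integrable_finsetSum _ fun f _ => ?_
  refine integrable_of_abs_le
    (((E.measurable_q_apply t n f).mono (E.ℱ.le t) le_rfl).pow_const 2) (C := C ^ 2) fun ω => ?_
  rw [abs_pow]
  exact pow_le_pow_left₀ (abs_nonneg _) (hC ω n f) 2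

/-- Expand `(q + Δ) ^ 2` with bounded `Δ`. Summation by parts turns the cross term of the
transmissions into the weight actually served, which is the maximal weight for the roles up to a
constant. -/
lemma exists_energy_succ_le [DecidableEq F]
    (hE : ∀ t ω, IsMaxOn (net.weight (E.q t ω)) (net.powerSet (E.s t ω)) (E.p t ω) ∧
      net.BackPressureRates (E.q t ω) (E.p t ω) (E.c t ω)) :
    ∃ K : ℝ, ∀ t ω, E.energy (t + 1) ω ≤ E.energy t ω + K +
      2 * ∑ n, ∑ f, E.q t ω n f * E.a t ω n f -
      2 * net.maxWeight (E.q t ω) (E.s t ω) := by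
  obtain ⟨D, hD0, hD⟩ := E.exists_increment_bound
  refine ⟨∑ _n : N, ∑ _f : F, D ^ 2 +
    2 * ∑ _n : N, ∑ _m : N, net.rateBound * ∑ _k : N, net.rateBound, fun t ω => ?_⟩
  have h1 : net.maxWeight (E.q t ω) (E.s t ω) ≤ net.weight (E.q t ω) (E.p t ω) :=
    maxWeight_le fun p hp => (hE t ω).1 hp
  have h2 := (hE t ω).2.weight_le (E.p_mem t ω) (E.q_nonneg t ω)
  have h3 : E.energy (t + 1) ω ≤ E.energy t ω + ∑ _n : N, ∑ _f : F, D ^ 2 +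
      2 * (∑ n, ∑ f, E.q t ω n f * ∑ m, (E.c t ω m n f - E.c t ω n m f)) +
      2 * ∑ n, ∑ f, E.q t ω n f * E.a t ω n f := by
    simp only [energy, Finset.mul_sum, ← Finset.sum_add_distrib]
    refine Finset.sum_le_sum fun n _ => Finset.sum_le_sum fun f _ => ?_
    rw [← Finset.mul_sum, ← Finset.mul_sum]
    by_cases h : n ∈ net.dst f
    · simp only [E.q_eq_zero_of_mem_dst _ ω h]
      nlinarith [sq_nonneg D]
    · have h4 := sq_le_sq' (abs_le.1 (hD t ω n f)).1 (abs_le.1 (hD t ω n f)).2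
      rw [E.q_succ, if_neg h]
      nlinarith
  rw [sum_mul_inflow_sub_outflow] at h3
  linarith

lemma setIntegral_sum_q_mul_a {x : N → F → ℝ} (hx : E.HasFixedRate x) (t : ℕ) {A : Set E.Ω}
    (hA : MeasurableSet[E.ℱ t] A) :
    ∫ ω in A, ∑ n, ∑ f, E.q t ω n f * E.a t ω n f ∂E.μ =
      ∫ ω in A, ∑ n, ∑ f, E.q t ω n f * x n f ∂E.μ := by
  have hint : ∀ n f, Integrable (fun ω => E.q t ω n f * E.a t ω n f) E.μ := by
    intro n f
    obtain ⟨C, _, hC⟩ := E.exists_q_le t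
    exact (E.integrable_a t n f).bdd_mul
      ((E.measurable_q_apply t n f).mono (E.ℱ.le t) le_rfl).aestronglyMeasurable
      (ae_of_all _ fun ω => hC ω n f)
  rw [integral_finsetSum _ fun n _ => integrable_finsetSum _ fun f _ => (hint n f).integrableOn,
    integral_finsetSum _ fun n _ => integrable_finsetSum _ fun f _ =>
      ((E.integrable_q t n f).mul_const _).integrableOn]
  refine Finset.sum_congr rfl fun n _ => ?_
  rw [integral_finsetSum _ fun f _ => (hint n f).integrableOn,
    integral_finsetSum _ fun f _ => ((E.integrable_q t n f).mul_const _).integrableOn]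
  refine Finset.sum_congr rfl fun f _ => ?_
  have ha : Measurable (E.a t) := (E.a_measurable t).mono (E.ℱ.le _) le_rfl
  have ha' : Measurable[MeasurableSpace.comap (E.a t) inferInstance] fun ω => E.a t ω n f :=
    (measurable_pi_apply f).comp ((measurable_pi_apply n).comp (comap_measurable (E.a t)))
  rw [setIntegral_mul_of_indep (hx t).1.symm (E.ℱ.le t) ha.comap_le (E.measurable_q_apply t n f)
    ha' hA,
    (hx t).2 n f, integral_mul_const]

open Classical in
-- The scheduler compares roles at `q (t + 1)`, but optimality of `r` is tested at `q t`: those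
-- queues are known before the draw, so independence applies to them. Passing between the two queue
-- vectors costs `weightLip * D` twice.
lemma gap_succ_le {D : ℝ} (hD0 : 0 ≤ D)
    (hD : ∀ t ω n f, |∑ m, (E.c t ω m n f - E.c t ω n m f) + E.a t ω n f| ≤ D)
    {t : ℕ} {ω : E.Ω} {r : N → Bool}
    (hs : E.s (t + 1) ω =
      if net.maxWeight (E.q (t + 1) ω) (E.s t ω) > net.maxWeight (E.q (t + 1) ω) r
      then E.s t ω else r) :
    E.gap (t + 1) ω ≤ 2 * (net.weightLip * D) +
      if net.maxWeight (E.q t ω) r < net.optWeight (E.q t ω) then E.gap t ω else 0 := by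
  have hq := E.abs_q_succ_sub_le hD0 hD t ω
  have hq' : ∀ n f, |E.q t ω n f - E.q (t + 1) ω n f| ≤ D := fun n f => by
    rw [abs_sub_comm]; exact hq n f
  have h1 := optWeight_le_add (net := net) hD0 hq
  have h2 := maxWeight_le_add (net := net) hD0 hq' (E.s t ω)
  have h3 := maxWeight_le_add (net := net) hD0 hq' r
  have h4 : net.maxWeight (E.q (t + 1) ω) (E.s t ω) ≤
      net.maxWeight (E.q (t + 1) ω) (E.s (t + 1) ω) ∧
      net.maxWeight (E.q (t + 1) ω) r ≤ net.maxWeight (E.q (t + 1) ω) (E.s (t + 1) ω) := by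
    rw [hs]
    split_ifs with h
    · exact ⟨le_rfl, h.le⟩
    · exact ⟨not_lt.1 h, le_rfl⟩
  unfold gap
  split_ifs with h
  · linarith [h4.1]
  · linarith [h4.2]

/-- The expected gap contracts: the new roles are the best ones for the current queues with a
probability that is bounded below. -/
lemma exists_setIntegral_gap_succ_le [DecidableEq F] (hE : E.IsPickAndCompare) :
    ∃ η K : ℝ, 0 < η ∧ ∀ t A, MeasurableSet[E.ℱ t] A →
      ∫ ω in A, E.gap (t + 1) ω ∂E.μ ≤ ∫ ω in A, (K + (1 - η) * E.gap t ω) ∂E.μ := by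
  classical
  obtain ⟨⟨pick, ν, hν, hpick⟩, -⟩ := hE
  obtain ⟨D, hD0, hD⟩ := E.exists_increment_bound
  -- There are finitely many role vectors, so the least of their probabilities is positive; it
  -- serves as `η`.
  obtain ⟨r₀, hr₀⟩ := Finite.exists_min ν
  have hν1 : ∀ r, ν r ≠ ⊤ := fun r => by
    rw [← (hpick 0).2.2.1 r]; exact measure_ne_top _ _
  refine ⟨(ν r₀).toReal, 2 * (net.weightLip * D), ENNReal.toReal_pos (hν r₀).ne' (hν1 r₀),
    fun t A hA => ?_⟩
  obtain ⟨hmeas, hind, hlaw, hs⟩ := hpick t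
  have hA' : MeasurableSet A := E.ℱ.le t A hA
  have hmeas' : Measurable (pick (t + 1)) := hmeas.mono (E.ℱ.le _) le_rfl
  let K := 2 * (net.weightLip * D)
  -- Up to `K`, `g r` bounds the next gap when `r` is drawn. It depends on the past only, whereas
  -- `ind r` is independent of the past, so `ind r` can be replaced by its mean `ν r`.
  let g : (N → Bool) → E.Ω → ℝ := fun r ω =>
    if net.maxWeight (E.q t ω) r < net.optWeight (E.q t ω) then E.gap t ω else 0
  let ind : (N → Bool) → E.Ω → ℝ := fun r => (pick (t + 1) ⁻¹' {r}).indicator 1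
  have hg : ∀ r, Measurable[E.ℱ t] (g r) := fun r =>
    Measurable.ite (measurableSet_lt (E.measurable_maxWeight_q t r) (E.measurable_optWeight_q t))
      (E.measurable_gap t) measurable_const
  have hgi : ∀ r, Integrable (g r) E.μ := fun r => by
    refine (E.integrable_gap t).mono
      ((hg r).mono (E.ℱ.le t) le_rfl).aestronglyMeasurable (ae_of_all _ fun ω => ?_)
    simp only [g]
    split_ifs <;> simp
  have hind' : ∀ r, Measurable[MeasurableSpace.comap (pick (t + 1)) inferInstance] (ind r) :=
    fun r => by
      have h1 : Measurable (Set.indicator ({r} : Set (N → Bool)) (1 : (N → Bool) → ℝ)) :=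
        measurable_one.indicator (measurableSet_singleton r)
      exact h1.comp (comap_measurable (pick (t + 1)))
  have hgind : ∀ r, Integrable (fun ω => g r ω * ind r ω) E.μ := fun r => by
    refine (hgi r).mul_bdd (c := 1)
      ((hind' r).mono hmeas'.comap_le le_rfl).aestronglyMeasurable (ae_of_all _ fun ω => ?_)
    simp only [ind, Set.indicator]
    split_ifs <;> simp
  have hsum : ∀ ω, ∑ r, g r ω * ind r ω = g (pick (t + 1) ω) ω := fun ω => by
    rw [Finset.sum_eq_single (pick (t + 1) ω)]
    · simp [ind]
    · intro r _ hr
      simp [ind, hr.symm]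
    · simp
  have hone : ∑ r, (ν r).toReal = 1 := by
    have h1 : ∀ r, (ν r).toReal = E.μ.real (pick (t + 1) ⁻¹' {r}) := fun r => by
      rw [← hlaw r]; rfl
    simp only [h1]
    rw [sum_measureReal_preimage_singleton _ fun r _ => hmeas' (measurableSet_singleton r)]
    simp
  have hmean : ∀ ω, ∑ r, g r ω * (ν r).toReal ≤ (1 - (ν r₀).toReal) * E.gap t ω := fun ω => by
    obtain ⟨r, hr⟩ := exists_maxWeight_eq_optWeight (net := net) (E.q t ω)
    -- An optimal role vector contributes nothing to the average, which saves the fraction `ν r ≥ ν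
    -- r₀` of the gap.
    have hgr : g r ω = 0 := if_neg hr.not_lt
    have h1 : ∑ r, g r ω * (ν r).toReal + E.gap t ω * (ν r).toReal ≤
        ∑ r, E.gap t ω * (ν r).toReal := by
      rw [← Finset.sum_erase_add _ _ (Finset.mem_univ r), hgr, zero_mul, add_zero,
        ← Finset.sum_erase_add (Finset.univ) (fun r => E.gap t ω * (ν r).toReal)
          (Finset.mem_univ r)]
      refine add_le_add_left (Finset.sum_le_sum fun r' _ =>
        mul_le_mul_of_nonneg_right ?_ ENNReal.toReal_nonneg) _
      simp only [g]
      split_ifs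
      · exact le_rfl
      · exact E.gap_nonneg t ω
    rw [← Finset.mul_sum, hone] at h1
    have h2 : (ν r₀).toReal ≤ (ν r).toReal := ENNReal.toReal_mono (hν1 r) (hr₀ r)
    have h3 := mul_le_mul_of_nonneg_left h2 (E.gap_nonneg t ω)
    linarith
  calc ∫ ω in A, E.gap (t + 1) ω ∂E.μ
      ≤ ∫ ω in A, (K + ∑ r, g r ω * ind r ω) ∂E.μ := by
        refine setIntegral_mono_on (E.integrable_gap _).integrableOn
          ((integrable_const _).add (integrable_finsetSum _ fun r _ => hgind r)).integrableOn hA'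
          fun ω _ => ?_
        rw [hsum]
        exact E.gap_succ_le hD0 hD (hs ω)
    _ = ∫ ω in A, (K + ∑ r, g r ω * (ν r).toReal) ∂E.μ := by
        rw [integral_add (integrable_const _)
            (integrable_finsetSum _ fun r _ => (hgind r).integrableOn),
          integral_add (integrable_const _)
            (integrable_finsetSum _ fun r _ => ((hgi r).mul_const _).integrableOn),
          integral_finsetSum _ fun r _ => (hgind r).integrableOn,
          integral_finsetSum _ fun r _ => ((hgi r).mul_const _).integrableOn]
        congr 1
        refine Finset.sum_congr rfl fun r _ => ?_
        rw [setIntegral_mul_of_indep hind.symm (E.ℱ.le t) hmeas'.comap_le (hg r) (hind' r) hA,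
          integral_mul_const, integral_indicator_one (hmeas' (measurableSet_singleton r)),
          ← hlaw r]
        rfl
    _ ≤ _ := by
        refine setIntegral_mono_on
          ((integrable_const _).add
            (integrable_finsetSum _ fun r _ => (hgi r).mul_const _)).integrableOn
          ((integrable_const _).add ((E.integrable_gap t).const_mul _)).integrableOn hA'
          fun ω _ => ?_
        exact add_le_add_right (hmean ω) _

lemma measurable_servedBacklog_q (t : ℕ) :
    Measurable[E.ℱ t] fun ω => net.servedBacklog (E.q t ω) := by
  refine Finset.measurable_sum _ fun n _ => Finset.measurable_sum _ fun f _ => ?_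
  by_cases h : net.Served n f
  · simpa only [h, if_true] using E.measurable_q_apply t n f
  · simp only [h, if_false]; exact measurable_const

lemma integrable_servedBacklog_q (t : ℕ) :
    Integrable (fun ω => net.servedBacklog (E.q t ω)) E.μ := by
  refine integrable_finsetSum _ fun n _ => integrable_finsetSum _ fun f _ => ?_
  by_cases h : net.Served n f
  · simpa only [h, if_true] using E.integrable_q t n f
  · simp only [h, if_false]; exact integrable_const _

/-- The packets that are cut off from their destinations are those of the initial queues. -/
lemma ae_backlog_le {x : N → F → ℝ} (hx : E.HasFixedRate x)
    (hx0 : ∀ n f, ¬ net.Served n f → x n f ≤ 0) :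
    ∀ᵐ ω ∂E.μ, ∀ t, E.backlog t ω ≤ net.servedBacklog (E.q t ω) + ∑ n, ∑ f, E.q₀ n f := by
  classical
  let y : N → F → ℝ := fun n f => if net.Served n f then 0 else 1
  have hyd : ∀ n f, n ∈ net.dst f → y n f = 0 := fun n f h =>
    if_pos ⟨n, h, SimpleGraph.Reachable.refl n⟩
  have hadj : ∀ n m f, net.links.Adj n m → (-y) n f = (-y) m f := fun n m f h => by
    have : net.Served n f ↔ net.Served m f :=
      ⟨fun ⟨d, hd, hn⟩ => ⟨d, hd, h.symm.reachable.trans hn⟩,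
        fun ⟨d, hd, hm⟩ => ⟨d, hd, h.reachable.trans hm⟩⟩
    simp only [Pi.neg_apply, y, this]
  -- Nonnegative arrivals with nonpositive mean vanish almost surely.
  have ha : ∀ᵐ ω ∂E.μ, ∀ t n f, y n f * E.a t ω n f = 0 := by
    refine ae_all_iff.2 fun t => ae_all_iff.2 fun n => ae_all_iff.2 fun f => ?_
    by_cases h : net.Served n f
    · simp [y, h]
    · have h0 : ∫ ω, E.a t ω n f ∂E.μ = 0 :=
        le_antisymm ((hx t).2 n f ▸ hx0 n f h) (integral_nonneg fun ω => E.a_nonneg t ω n f)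
      rw [integral_eq_zero_iff_of_nonneg (fun ω => E.a_nonneg t ω n f)
        (E.integrable_a t n f)] at h0
      filter_upwards [h0] with ω hω
      have hω' : E.a t ω n f = 0 := hω
      rw [hω', mul_zero]
  filter_upwards [ha] with ω hω
  have hcut : ∀ t, ∑ n, ∑ f, y n f * E.q t ω n f ≤ ∑ n, ∑ f, E.q₀ n f := by
    intro t
    induction t with
    | zero =>
      rw [E.q_zero]
      refine Finset.sum_le_sum fun n _ => Finset.sum_le_sum fun f _ => ?_
      have := E.q₀_nonneg n f
      by_cases h : net.Served n f <;> simp [y, h, this]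
    | succ t ih =>
      rw [E.sum_mul_q_succ hyd]
      have h1 : ∑ n, ∑ f, y n f * E.a t ω n f = 0 := by simp [hω t]
      -- Applied to `-y`, the weight bound becomes a lower bound for the outflow of `y·q`, so
      -- transmissions do not increase the cut-off backlog.
      have h2 := ((E.c_feasible t ω).sum_le_maxWeight (E.p_mem t ω) (-y)).trans
        ((maxWeight_le_optWeight _ _).trans (optWeight_nonpos hadj))
      have h3 : ∑ n, ∑ m, ∑ f, E.c t ω n m f * ((-y) n f - (-y) m f) =
          -∑ n, ∑ m, ∑ f, E.c t ω n m f * (y n f - y m f) := by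
        simp only [← Finset.sum_neg_distrib, Pi.neg_apply]
        refine Finset.sum_congr rfl fun n _ => Finset.sum_congr rfl fun m _ =>
          Finset.sum_congr rfl fun f _ => by ring
      linarith
  intro t
  have hsplit : E.backlog t ω =
      net.servedBacklog (E.q t ω) + ∑ n, ∑ f, y n f * E.q t ω n f := by
    simp only [backlog, servedBacklog, ← Finset.sum_add_distrib]
    refine Finset.sum_congr rfl fun n _ => Finset.sum_congr rfl fun f _ => ?_
    by_cases h : net.Served n f <;> simp [y, h]
  rw [hsplit]
  exact add_le_add_right (hcut t) _

/-- The drift inequality for the energy plus a multiple of the gap. -/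
lemma exists_drift [DecidableEq F] (hE : E.IsPickAndCompare) {x : N → F → ℝ}
    (hx : E.HasFixedRate x) (hcap : x ∈ net.strictCapacityRegion) :
    ∃ θ b ε : ℝ, 0 ≤ θ ∧ 0 < ε ∧ ∀ t A, MeasurableSet[E.ℱ t] A →
      ∫ ω in A, (E.energy (t + 1) ω + θ * E.gap (t + 1) ω) ∂E.μ ≤
        ∫ ω in A, ((E.energy t ω + θ * E.gap t ω) +
          (b - ε * net.servedBacklog (E.q t ω))) ∂E.μ := by
  obtain ⟨ρ, hρ, hcap⟩ := hcap
  obtain ⟨η, K₁, hη, hgap⟩ := E.exists_setIntegral_gap_succ_le hE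
  obtain ⟨K₂, henergy⟩ := E.exists_energy_succ_le hE.2
  obtain ⟨M, hM, hserved⟩ := net.exists_servedBacklog_le
  have hρ0 : 0 < ρ := by linarith
  have hε : 0 < 1 - ρ⁻¹ := sub_pos.2 (inv_lt_one_of_one_lt₀ hρ)
  -- With `θ = 2 / η` the contraction of `θ * gap` gains exactly `2 * gap`, the loss in the energy
  -- drift. The rate `ε` is the margin `2 * (1 - ρ⁻¹)` divided by the constant `M` that compares the
  -- served backlog with `optWeight`.
  refine ⟨2 / η, K₂ + 2 / η * K₁, 2 * (1 - ρ⁻¹) / M, by positivity, by positivity,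
    fun t A hA => ?_⟩
  have hA' : MeasurableSet A := E.ℱ.le t A hA
  have hqa : Integrable (fun ω => ∑ n, ∑ f, E.q t ω n f * E.a t ω n f) E.μ := by
    refine integrable_finsetSum _ fun n _ => integrable_finsetSum _ fun f _ => ?_
    obtain ⟨C, _, hC⟩ := E.exists_q_le t
    exact (E.integrable_a t n f).bdd_mul
      ((E.measurable_q_apply t n f).mono (E.ℱ.le t) le_rfl).aestronglyMeasurable
      (ae_of_all _ fun ω => hC ω n f)
  have hqx : Integrable (fun ω => ∑ n, ∑ f, E.q t ω n f * x n f) E.μ :=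
    integrable_finsetSum _ fun n _ => integrable_finsetSum _ fun f _ =>
      (E.integrable_q t n f).mul_const _
  have hbase : Integrable (fun ω => E.energy t ω + K₂ - 2 * net.optWeight (E.q t ω) +
      2 * E.gap t ω) E.μ :=
    (((E.integrable_energy t).add (integrable_const _)).sub
      ((E.integrable_optWeight_q t).const_mul _)).add ((E.integrable_gap t).const_mul _)
  have h1 : ∫ ω in A, E.energy (t + 1) ω ∂E.μ ≤
      ∫ ω in A, ((E.energy t ω + K₂ - 2 * net.optWeight (E.q t ω) + 2 * E.gap t ω) +
        2 * ∑ n, ∑ f, E.q t ω n f * x n f) ∂E.μ := by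
    calc ∫ ω in A, E.energy (t + 1) ω ∂E.μ
        ≤ ∫ ω in A, ((E.energy t ω + K₂ - 2 * net.optWeight (E.q t ω) + 2 * E.gap t ω) +
          2 * ∑ n, ∑ f, E.q t ω n f * E.a t ω n f) ∂E.μ := by
          refine setIntegral_mono_on (E.integrable_energy _).integrableOn
            (hbase.add (hqa.const_mul _)).integrableOn hA' fun ω _ => ?_
          have := henergy t ω
          unfold gap
          linarith
      _ = _ := by
          rw [integral_add hbase.integrableOn (hqa.const_mul _).integrableOn,
            integral_add hbase.integrableOn (hqx.const_mul _).integrableOn,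
            integral_const_mul, integral_const_mul, E.setIntegral_sum_q_mul_a hx t hA]
  rw [integral_add (E.integrable_energy _).integrableOn
    ((E.integrable_gap _).const_mul _).integrableOn, integral_const_mul]
  have hθ : 0 ≤ 2 / η := by positivity
  refine (add_le_add h1 (mul_le_mul_of_nonneg_left (hgap t A hA) hθ)).trans ?_
  have hi₁ : Integrable (fun ω => (E.energy t ω + K₂ - 2 * net.optWeight (E.q t ω) +
      2 * E.gap t ω) + 2 * ∑ n, ∑ f, E.q t ω n f * x n f) E.μ := hbase.add (hqx.const_mul _)
  have hi₂ : Integrable (fun ω => 2 / η * (K₁ + (1 - η) * E.gap t ω)) E.μ :=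
    ((integrable_const _).add ((E.integrable_gap t).const_mul _)).const_mul _
  rw [← integral_const_mul, ← integral_add hi₁.integrableOn hi₂.integrableOn]
  refine setIntegral_mono_on (hi₁.add hi₂).integrableOn
    (((E.integrable_energy t).add ((E.integrable_gap t).const_mul _)).add
      ((integrable_const _).sub
        ((E.integrable_servedBacklog_q t).const_mul _))).integrableOn hA' fun ω _ => ?_
  -- The outer bound is tested in the direction of the current queues; the slack in `ρ` is the
  -- source of the negative drift.
  have h2 := sum_mul_le_optWeight hcap (E.q_nonneg t ω)
    fun n f h => E.q_eq_zero_of_mem_dst t ω h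
  have h3 : ∑ n, ∑ f, E.q t ω n f * (ρ • x) n f = ρ * ∑ n, ∑ f, E.q t ω n f * x n f := by
    simp only [Finset.mul_sum, Pi.smul_apply, smul_eq_mul]
    exact Finset.sum_congr rfl fun n _ => Finset.sum_congr rfl fun f _ => by ring
  rw [h3, ← le_inv_mul_iff₀ hρ0] at h2
  have h4 : 2 * (1 - ρ⁻¹) / M * net.servedBacklog (E.q t ω) ≤
      2 * (1 - ρ⁻¹) * net.optWeight (E.q t ω) := by
    rw [div_mul_eq_mul_div, div_le_iff₀ hM, mul_assoc _ _ M, mul_comm _ M]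
    exact mul_le_mul_of_nonneg_left
      (hserved _ fun n f h => E.q_eq_zero_of_mem_dst t ω h) (by positivity)
  have h5 : 2 / η * (K₁ + (1 - η) * E.gap t ω) =
      2 / η * K₁ + 2 / η * E.gap t ω - 2 * E.gap t ω := by
    field_simp
    ring
  rw [h5]
  linarith

end Evolution

end MmWaveNetwork

/-! ### Stability from the drift inequality -/

theorem proposition3 {N : Type v} {F : Type w} [Fintype N] [DecidableEq N] [Fintype F]
    [DecidableEq F] (net : MmWaveNetwork N F) :
    net.ThroughputOptimal {E : MmWaveNetwork.Evolution.{u, v, w} net | E.IsPickAndCompare} := by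
  intro x hx E hE hrate
  obtain ⟨θ, b, ε, hθ, hε, hdrift⟩ := E.exists_drift hE hrate hx
  have hx0 : ∀ n f, ¬ net.Served n f → x n f ≤ 0 := fun n f h => by
    obtain ⟨ρ, hρ, hcap⟩ := hx
    have h1 : ρ * x n f ≤ 0 := MmWaveNetwork.nonpos_of_not_served hcap h
    exact nonpos_of_mul_nonpos_right h1 (by linarith)
  have hback := E.ae_backlog_le hrate hx0
  have hV0 : ∀ t ω, 0 ≤ E.energy t ω + θ * E.gap t ω := fun t ω =>
    add_nonneg (E.energy_nonneg t ω) (mul_nonneg hθ (E.gap_nonneg t ω))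
  have hVi : ∀ t, Integrable (fun ω => E.energy t ω + θ * E.gap t ω) E.μ := fun t =>
    (E.integrable_energy t).add ((E.integrable_gap t).const_mul _)
  -- Both levels are those of the criteria for the served backlog, raised by the initial backlog,
  -- which bounds the cut-off packets.
  refine ⟨⟨(b + 1) / ε + ∑ n, ∑ f, E.q₀ n f, ?_⟩,
    (∫ ω, (E.energy 0 ω + θ * E.gap 0 ω) ∂E.μ + b) / ε + ∑ n, ∑ f, E.q₀ n f, fun T hT => ?_⟩
  · filter_upwards [hback, ae_frequently_le_of_drift E.measurable_servedBacklog_q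
      E.integrable_servedBacklog_q hVi hV0 hε hdrift] with ω h1 h2
    exact h2.mono fun t ht => (h1 t).trans (add_le_add_left ht _)
  · have h1 := sum_integral_div_le_of_drift E.integrable_servedBacklog_q hVi hV0 hε hdrift hT
    have hT' : (0 : ℝ) < T := by exact_mod_cast hT
    have h2 : ∀ t, ∫ ω, E.backlog t ω ∂E.μ ≤
        ∫ ω, net.servedBacklog (E.q t ω) ∂E.μ + ∑ n, ∑ f, E.q₀ n f := fun t => by
      have h3 : ∫ ω, (net.servedBacklog (E.q t ω) + ∑ n, ∑ f, E.q₀ n f) ∂E.μ =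
          ∫ ω, net.servedBacklog (E.q t ω) ∂E.μ + ∑ n, ∑ f, E.q₀ n f := by
        rw [integral_add (E.integrable_servedBacklog_q t) (integrable_const _)]
        simp
      rw [← h3]
      refine integral_mono_ae (E.integrable_backlog t)
        ((E.integrable_servedBacklog_q t).add (integrable_const _)) ?_
      filter_upwards [hback] with ω hω using hω t
    rw [div_le_iff₀ hT'] at h1 ⊢
    refine (Finset.sum_le_sum fun t _ => h2 t).trans ?_
    rw [Finset.sum_add_distrib]
    simp only [Finset.sum_const, Finset.card_range, nsmul_eq_mul]
    linarith
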